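/- Let $n\ge 2$, $d\ge 1$, let $m_1,\dots,m_n>0$, and let $M=\{q\in(\mathbb R^d)^n : \sum_i m_iq_i=0\}$ carry the inner product $\langle q,q'\rangle=\sum_i m_i\,q_i\cdot q_i'$. Let $\Delta=\{q\in M: q_i=q_j\text{ for some }i\ne j\}$, $\widehat M=M\setminus\Delta$, and $S^{(n-1)d-1}=\{q\in M:\|q\|=1\}$. For a partition $\mathcal C$ of $\{1,\dots,n\}$ into $|\mathcal C|$ clusters let $\Delta^E_{\mathcal C}=\{q\in M: q_i=q_j \text{ whenever } i,j \text{ lie in the same cluster of }\mathcal C\}$, let $\Delta^I_{\mathcal C}$ be its orthogonal complement in $M$, and write $q=q^E_{\mathcal C}+q^I_{\mathcal C}$ for the corresponding decomposition; let $\mathcal C_{\min}$ be the partition into singletons. For $\delta\in(0,1)$ the free atom of the Graf partition is $$\Xi^{(\delta)}_{\mathcal C_{\min}}=\Big\{q\in M:\ \|q\|^2+\delta^{n}=\max_{\mathcal C}\big(\|q^E_{\mathcal C}\|^2+\delta^{|\mathcal C|}\big)\Big\},$$ the maximum being over all partitions $\mathcal C$ of $\{1,\dots,n\}$; $\partial\,\Xi^{(\delta)}_{\mathcal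 C_{\min}}$ is its topological boundary in $M$. Let $S^I_{\mathcal C}$ be the unit sphere of $\Delta^I_{\mathcal C}$ and $[M:\Delta^E_{\mathcal C}]=\Delta^E_{\mathcal C}\times[0,\infty)\times S^I_{\mathcal C}$. The collision blow-up $\wideparen M_\Delta$ is the closure of the image of the embedding $$\hat I_\Delta:\widehat M\to\prod_{\mathcal C\ne\mathcal C_{\min}}[M:\Delta^E_{\mathcal C}],\qquad q\mapsto\Big(q^E_{\mathcal C},\ \|q^I_{\mathcal C}\|,\ q^I_{\mathcal C}/\|q^I_{\mathcal C}\|\Big)_{\mathcal C},$$ and $\partial\wideparen M_\Delta=\wideparen M_\Delta\setminus\hat I_\Delta(\widehat M)$ is its boundary (as a manifold with corners). Then for every $\delta\in(0,1)$: 1. For every $s\in S^{(n-1)d-1}\setminus\Delta$ the ray $\{\lambda s:\lambda>0\}$ meets $\partial\,\Xi^{(\delta)}_{\mathcal C_{\min}}$ in exactly one point $H^{(\delta)}(s)$, and $H^{(\delta)}$ is a homeomorphism from $S^{(n-1)d-1}\setminus\Delta$ onto $\partial\,\Xi^{(\delta)}_{\mathcal C_{\min}}$. 2. $\partial\,\Xi^{(\delta)}_{\mathcal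 C_{\min}}$ is homeomorphic to $\partial\wideparen M_\Delta$. -/

import Mathlib

namespace NBody

noncomputable section

/-- Partitions (cluster decompositions) of the label set `{1, …, n}`. The order of Mathlib is
refinement: `⊥` is the partition into singletons, and `C ≤ D` says that `C` is finer than `D`.
`C.part i` is the cluster (atom) that contains `i`, and `C.parts.card` is the rank. -/
abbrev ClusterPartition (n : ℕ) : Type := Finpartition (Finset.univ : Finset (Fin n))

/-- The partitions different from the finest one; they index the collision subspaces. -/
abbrev CollisionPartition (n : ℕ) : Type := {C : ClusterPartition n // C ≠ ⊥}

/-- Centre of mass zero configuration space of `n` particles with masses `m` in `ℝ^d`. -/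
def Conf {n : ℕ} (d : ℕ) (m : Fin n → ℝ) : Submodule ℝ (Fin n → EuclideanSpace ℝ (Fin d)) where
  carrier := {q | ∑ i, m i • q i = 0}
  zero_mem' := by simp
  add_mem' := by
    intro p q hp hq
    simp only [Set.mem_ofPred_eq, Pi.add_apply, smul_add, Finset.sum_add_distrib] at *
    rw [hp, hq, add_zero]
  smul_mem' := by
    intro c q hq
    simp only [Set.mem_ofPred_eq, Pi.smul_apply] at *
    simp_rw [smul_comm _ c]
    rw [← Finset.smul_sum, hq, smul_zero]

section

variable {n d : ℕ} {m : Fin n → ℝ}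

/-- The mass inner product `⟨p, q⟩ = ∑ i, m i * ⟨p i, q i⟩`. -/
def massInner (p q : Conf d m) : ℝ := ∑ i, m i * inner ℝ (p.1 i) (q.1 i)

/-- The scalar moment of inertia, i.e. the square of the mass norm. -/
def inertia (q : Conf d m) : ℝ := massInner q q

theorem massInner_sub_right (p q r : Conf d m) :
    massInner p (q - r) = massInner p q - massInner p r := by
  simp [massInner, inner_sub_right, mul_sub, Finset.sum_sub_distrib]

theorem massInner_add_right (p q r : Conf d m) :
    massInner p (q + r) = massInner p q + massInner p r := by
  simp [massInner, inner_add_right, mul_add, Finset.sum_add_distrib]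

theorem massInner_smul_right (c : ℝ) (p q : Conf d m) :
    massInner p (c • q) = c * massInner p q := by
  simp only [massInner, Submodule.coe_smul, Pi.smul_apply, inner_smul_right, Finset.mul_sum]
  exact Finset.sum_congr rfl fun i _ => by ring

theorem inertia_smul (c : ℝ) (q : Conf d m) : inertia (c • q) = c ^ 2 * inertia q := by
  simp only [inertia, massInner, Submodule.coe_smul, Pi.smul_apply, inner_smul_left,
    inner_smul_right, Finset.mul_sum, conj_trivial]
  exact Finset.sum_congr rfl fun i _ => by ring

theorem inertia_nonneg (hm : ∀ i, 0 < m i) (q : Conf d m) : 0 ≤ inertia q := by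
  unfold inertia massInner
  exact Finset.sum_nonneg fun i _ => mul_nonneg (hm i).le real_inner_self_nonneg

theorem inertia_pos (hm : ∀ i, 0 < m i) {q : Conf d m} (hq : q ≠ 0) : 0 < inertia q := by
  refine lt_of_le_of_ne (inertia_nonneg hm q) fun h => hq ?_
  unfold inertia massInner at h
  have h0 := (Finset.sum_eq_zero_iff_of_nonneg fun i _ =>
    mul_nonneg (hm i).le (real_inner_self_nonneg (x := q.1 i))).1 h.symm
  refine Subtype.ext (funext fun i => ?_)
  have hi := h0 i (Finset.mem_univ i)
  rcases mul_eq_zero.1 hi with h1 | h1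
  · exact absurd h1 (hm i).ne'
  · simpa using inner_self_eq_zero.1 h1

variable (d m) in
/-- The collision set (thick diagonal). -/
def collisionSet : Set (Conf d m) := {q | ∃ i j, i ≠ j ∧ q.1 i = q.1 j}

variable (d m) in
/-- The unit sphere of the mass norm, without its collision points. -/
def puncturedSphere : Set (Conf d m) := {s | inertia s = 1} \ collisionSet d m

variable (d m) in
/-- The collision subspace of a partition: particles in the same cluster coincide. -/
def external (C : ClusterPartition n) : Submodule ℝ (Conf d m) where
  carrier := {q | ∀ i j, C.part i = C.part j → q.1 i = q.1 j}
  zero_mem' := by intro i j _; rfl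
  add_mem' := by
    intro p q hp hq i j hij
    simp [hp i j hij, hq i j hij]
  smul_mem' := by
    intro c q hq i j hij
    simp [hq i j hij]

variable (d m) in
/-- The orthogonal complement, for the mass inner product, of the collision subspace. -/
def internal (C : ClusterPartition n) : Submodule ℝ (Conf d m) where
  carrier := {q | ∀ p ∈ external d m C, massInner p q = 0}
  zero_mem' := by intro p _; simp [massInner]
  add_mem' := by
    intro q r hq hr p hp
    rw [massInner_add_right, hq p hp, hr p hp, add_zero]
  smul_mem' := by
    intro c q hq p hp
    rw [massInner_smul_right, hq p hp, mul_zero]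

/-- The barycentre of the cluster `A`. -/
def barycenter (q : Conf d m) (A : Finset (Fin n)) : EuclideanSpace ℝ (Fin d) :=
  (∑ i ∈ A, m i)⁻¹ • ∑ i ∈ A, m i • q.1 i

theorem sum_part_eq {E : Type*} [AddCommMonoid E] (C : ClusterPartition n)
    (f : Finset (Fin n) → Fin n → E) :
    ∑ i, f (C.part i) i = ∑ A ∈ C.parts, ∑ i ∈ A, f A i := by
  have h : ∀ g : Fin n → E, ∑ i, g i = ∑ i ∈ C.parts.biUnion id, g i := fun g => by
    rw [C.biUnion_parts]
  rw [h, Finset.sum_biUnion C.supIndep.pairwiseDisjoint]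
  refine Finset.sum_congr rfl fun A hA => Finset.sum_congr rfl fun i hi => ?_
  rw [C.part_eq_of_mem hA hi]

theorem clusterMass_smul_barycenter (hm : ∀ i, 0 < m i) (q : Conf d m) (A : Finset (Fin n)) :
    (∑ i ∈ A, m i) • barycenter q A = ∑ i ∈ A, m i • q.1 i := by
  rcases A.eq_empty_or_nonempty with rfl | hA
  · simp
  · rw [barycenter, smul_inv_smul₀ (Finset.sum_pos (fun i _ => hm i) hA).ne']

/-- The projection to the collision subspace of `C` along its orthogonal complement:
every particle is put into the barycentre of its cluster. -/
def projE (hm : ∀ i, 0 < m i) (C : ClusterPartition n) (q : Conf d m) : Conf d m :=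
  ⟨fun i => barycenter q (C.part i), by
    change ∑ i, m i • barycenter q (C.part i) = 0
    rw [sum_part_eq C fun A i => m i • barycenter q A]
    simp_rw [← Finset.sum_smul, clusterMass_smul_barycenter hm]
    rw [← sum_part_eq C fun _ i => m i • q.1 i]
    exact q.2⟩

/-- The complementary projection, to the internal coordinates of the clusters of `C`. -/
def projI (hm : ∀ i, 0 < m i) (C : ClusterPartition n) (q : Conf d m) : Conf d m := q - projE hm C q

theorem projE_mem (hm : ∀ i, 0 < m i) (C : ClusterPartition n) (q : Conf d m) :
    projE hm C q ∈ external d m C := by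
  intro i j hij
  simp only [projE, hij]

theorem projI_mem (hm : ∀ i, 0 < m i) (C : ClusterPartition n) (q : Conf d m) :
    projI hm C q ∈ internal d m C := by
  intro p hp
  rw [projI, massInner_sub_right, sub_eq_zero]
  have key : ∀ r : Fin n → EuclideanSpace ℝ (Fin d),
      ∑ i, m i * inner ℝ (p.1 i) (r i)
        = ∑ A ∈ C.parts, ∑ i ∈ A, m i * inner ℝ (p.1 i) (r i) := fun r =>
    sum_part_eq C fun _ i => m i * inner ℝ (p.1 i) (r i)
  have e : massInner p (projE hm C q)
      = ∑ A ∈ C.parts, ∑ i ∈ A, m i * inner ℝ (p.1 i) (barycenter q A) :=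
    sum_part_eq C fun A i => m i * inner ℝ (p.1 i) (barycenter q A)
  rw [e, massInner, key]
  refine Finset.sum_congr rfl fun A hA => ?_
  obtain ⟨a, ha⟩ := C.nonempty_of_mem_parts hA
  have hpa : ∀ i ∈ A, p.1 i = p.1 a := fun i hi =>
    hp i a (by rw [C.part_eq_of_mem hA hi, C.part_eq_of_mem hA ha])
  have h1 : ∀ r : Fin n → EuclideanSpace ℝ (Fin d),
      ∑ i ∈ A, m i * inner ℝ (p.1 i) (r i) = inner ℝ (p.1 a) (∑ i ∈ A, m i • r i) := by
    intro r
    rw [inner_sum]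
    exact Finset.sum_congr rfl fun i hi => by rw [hpa i hi, inner_smul_right]
  rw [h1, h1 fun _ => barycenter q A, ← Finset.sum_smul, clusterMass_smul_barycenter hm]

theorem projI_ne_zero (hm : ∀ i, 0 < m i) {C : ClusterPartition n} (hC : C ≠ ⊥) {q : Conf d m}
    (hq : q ∉ collisionSet d m) : projI hm C q ≠ 0 := by
  intro h
  have hqE : q ∈ external d m C := by
    rw [sub_eq_zero.1 h]
    exact projE_mem hm C q
  refine hC (le_antisymm (fun A hA => ?_) bot_le)
  obtain ⟨a, ha⟩ := C.nonempty_of_mem_parts hA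
  refine ⟨{a}, Finpartition.mem_bot_iff.2 ⟨a, Finset.mem_univ a, rfl⟩, fun i hi => ?_⟩
  by_contra hne
  exact hq ⟨i, a, by simpa using hne,
    hqE i a (by rw [C.part_eq_of_mem hA hi, C.part_eq_of_mem hA ha])⟩

/-- The function `J^{(δ)}` that defines the Graf partition. -/
def grafMax (hm : ∀ i, 0 < m i) (δ : ℝ) (q : Conf d m) : ℝ :=
  (Finset.univ : Finset (ClusterPartition n)).sup' ⟨⊥, Finset.mem_univ _⟩
    fun C => inertia (projE hm C q) + δ ^ C.parts.card

variable (d) in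
/-- The atom of the Graf partition that belongs to the cluster decomposition `C`. -/
def grafAtom (hm : ∀ i, 0 < m i) (δ : ℝ) (C : ClusterPartition n) : Set (Conf d m) :=
  {q | inertia (projE hm C q) + δ ^ C.parts.card = grafMax hm δ q}

variable (d) in
/-- The topological boundary, in configuration space, of the free atom. -/
def freeBoundary (hm : ∀ i, 0 < m i) (δ : ℝ) : Set (Conf d m) := frontier (grafAtom d hm δ ⊥)

variable (d m) in
/-- The sphere of internal configurations of `C` with moment of inertia one. -/
abbrev InternalSphere (C : ClusterPartition n) : Type := {x : internal d m C // inertia x.1 = 1}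

variable (d m) in
/-- The blow-up of the configuration space along the collision subspace of `C`, written in
orthogonal polar coordinates `(q^E, r, Q)`. -/
abbrev BlowUp (C : ClusterPartition n) : Type := external d m C × Set.Ici (0 : ℝ) × InternalSphere d m C

/-- The polar coordinates of a collision-free configuration with respect to `C`. -/
def polar (hm : ∀ i, 0 < m i) (C : CollisionPartition n)
    (q : {q : Conf d m // q ∉ collisionSet d m}) : BlowUp d m C.1 :=
  (⟨projE hm C.1 q.1, projE_mem hm C.1 q.1⟩,
    ⟨√(inertia (projI hm C.1 q.1)), Real.sqrt_nonneg _⟩,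
    ⟨⟨(√(inertia (projI hm C.1 q.1)))⁻¹ • projI hm C.1 q.1,
      (internal d m C.1).smul_mem _ (projI_mem hm C.1 q.1)⟩, by
      have h := inertia_pos hm (projI_ne_zero hm C.2 q.2)
      rw [inertia_smul, inv_pow, Real.sq_sqrt h.le, inv_mul_cancel₀ h.ne']⟩)

variable (d) in
/-- The diagonal embedding of the collision-free configurations. -/
def diagonalMap (hm : ∀ i, 0 < m i) (q : {q : Conf d m // q ∉ collisionSet d m}) :
    ∀ C : CollisionPartition n, BlowUp d m C.1 := fun C => polar hm C q

variable (d) in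
/-- The graph blow-up of the configuration space at the collisions. -/
def graphBlowUp (hm : ∀ i, 0 < m i) : Set (∀ C : CollisionPartition n, BlowUp d m C.1) :=
  closure (Set.range (diagonalMap d hm))

variable (d) in
/-- The boundary of the graph blow-up as a manifold with corners: its interior is the (embedded)
space of collision-free configurations. -/
def blowUpBoundary (hm : ∀ i, 0 < m i) : Set (∀ C : CollisionPartition n, BlowUp d m C.1) :=
  graphBlowUp d hm \ Set.range (diagonalMap d hm)

end

end

end NBody

/-!
The free atom is the set where a continuous function `freeGauge`, homogeneous of degree one and
zero exactly at the collisions, is at least one. Its boundary is therefore the level set one, and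
rescaling along the rays (`exists_radial_homeomorph`) identifies it with the punctured sphere, for
every `δ`. What remains is that the boundary of the graph blow-up is homeomorphic to the punctured
sphere.

Let `perp E C` be the orthogonal projection to the complement of the collision subspace `E C`. The
gradient `q + ∑ C, perp E C q / ‖perp E C q‖` of the convex function
`‖q‖ ^ 2 / 2 + ∑ C, ‖perp E C q‖` extends continuously to the blow-up, as the normal directions are
part of the data there: this is the map `outward`. It moves the boundary off the collisions, and
radial projection of the image of the boundary is the required homeomorphism
(`IsSphericalBlowUp.nonempty_homeomorph`).

* Monotonicity of gradients makes `outward` injective, also at the boundary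
  (`outward_injective`), and it is proper.
* Each ray meets the image of the boundary at most once. Pairing `outward` with the normal direction
  `U D` of a point is bounded below by `∑ ‖perp E C (U D)‖`, the sum over the `C` with
  `E D ≤ E C` (`sum_le_inner_outward`). If the base point lies in `E D` and in no collision subspace
  that does not contain `E D`, then for each `x` normal to `E D` the pairing with `x` is bounded
  above by `∑ ‖perp E C x‖`, over the same `C` (`inner_outward_le_sum`). Hence no multiple with a factor above one of a value of `outward` is a
  value at a boundary point.
* Each ray outside the collisions meets that image: the values at collision-free points form an open
  set by minimisation of a strongly convex function (`exists_outward_eq`), which contains the far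
  end of the ray, and a first point of the image on the ray comes from the boundary.

The two bounds for the pairing need that averaging over the clusters of `D` does not increase
`∑ ‖perp E C q‖` over the `C` with `¬ E D ≤ E C`. For equal masses the projection to `E D` is an
average over relabellings of the particles that merely permute these terms
(`isAveragingFamily_coincide`). The blow-up for arbitrary masses carries normal directions for the
equal mass inner product as well, because both describe the directions in the quotient by `E C`
(`isSphericalBlowUp_graphBlowUp`); so equal masses suffice.
-/

namespace NBody

open Filter Topology

/-! ### Subspace arrangements and their spherical blow-ups -/

/-- Rescaled unit vectors form a monotone relation. -/
theorem inner_unit_sub_nonneg {V : Type*} [NormedAddCommGroup V]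
    [InnerProductSpace ℝ V] {u v : V} (hu : ‖u‖ = 1) (hv : ‖v‖ = 1) {s t : ℝ} (hs : 0 ≤ s)
    (ht : 0 ≤ t) : 0 ≤ inner ℝ (u - v) (s • u - t • v) := by
  have h1 : inner ℝ u v ≤ (1 : ℝ) := by simpa [hu, hv] using real_inner_le_norm u v
  have h2 : inner ℝ (u - v) (s • u - t • v) = (s + t) * (1 - inner ℝ u v) := by
    simp only [inner_sub_left, inner_sub_right, inner_smul_right, real_inner_self_eq_norm_sq,
      hu, hv, real_inner_comm u v]
    ring
  rw [h2]
  exact mul_nonneg (by positivity) (by linarith)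

section Arrangement

variable {W : Type*} [NormedAddCommGroup W] [InnerProductSpace ℝ W] [FiniteDimensional ℝ W]
  {ι : Type*}

/-- The component of `x` orthogonal to the subspace `E C`. -/
noncomputable abbrev perp (E : ι → Submodule ℝ W) (C : ι) (x : W) : W := (E C)ᗮ.starProjection x

section Perp

variable {E : ι → Submodule ℝ W} {C D : ι} {x u : W}

theorem perp_eq_zero_iff : perp E C x = 0 ↔ x ∈ E C := by
  rw [perp, Submodule.starProjection_apply_eq_zero_iff, Submodule.orthogonal_orthogonal]

theorem perp_mem (E : ι → Submodule ℝ W) (C : ι) (x : W) : perp E C x ∈ (E C)ᗮ :=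
  Submodule.starProjection_apply_mem _ _

theorem perp_eq_self (hu : u ∈ (E C)ᗮ) : perp E C u = u :=
  Submodule.starProjection_eq_self_iff.2 hu

theorem inner_perp (hu : u ∈ (E C)ᗮ) (x : W) : inner ℝ u (perp E C x) = inner ℝ u x := by
  rw [perp, ← Submodule.inner_starProjection_left_eq_right,
    Submodule.starProjection_eq_self_iff.2 hu]

theorem norm_perp_le (E : ι → Submodule ℝ W) (C : ι) (x : W) : ‖perp E C x‖ ≤ ‖x‖ :=
  Submodule.norm_starProjection_apply_le _ _

theorem perp_add_starProjection (E : ι → Submodule ℝ W) (C : ι) (x : W) :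
    perp E C x + (E C).starProjection x = x := by
  rw [add_comm]; exact Submodule.starProjection_add_starProjection_orthogonal x

theorem perp_of_eq_add {e : W} (hu : u ∈ (E C)ᗮ) (he : e ∈ E C) (hx : x = u + e) :
    perp E C x = u := by
  rw [hx, perp, map_add, Submodule.starProjection_eq_self_iff.2 hu,
    show (E C)ᗮ.starProjection e = 0 from perp_eq_zero_iff.2 he, add_zero]

theorem perp_perp (h : E D ≤ E C) (x : W) : perp E C (perp E D x) = perp E C x := by
  have h1 : perp E C ((E D).starProjection x) = 0 :=
    perp_eq_zero_iff.2 (h (Submodule.starProjection_apply_mem _ _))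
  conv_rhs => rw [← perp_add_starProjection E D x, perp, map_add]
  rw [perp] at h1
  rw [h1, add_zero]

/-- The norm `‖perp E C ·‖` is differentiable along lines outside `E C`. -/
theorem hasDerivAt_norm_perp (hu : perp E C x = ‖perp E C x‖ • u) (huC : u ∈ (E C)ᗮ)
    (hx : x ∉ E C) (v : W) :
    HasDerivAt (fun t : ℝ => ‖perp E C (x + t • v)‖) (inner ℝ u v) 0 := by
  have hx0 : perp E C x ≠ 0 := fun h => hx (perp_eq_zero_iff.1 h)
  have hn : ‖perp E C x‖ ≠ 0 := norm_ne_zero_iff.2 hx0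
  have h1 : HasDerivAt (fun t : ℝ => perp E C (x + t • v)) (perp E C v) 0 := by
    have h2 : HasDerivAt (fun t : ℝ => x + t • v) v 0 := by
      simpa using ((hasDerivAt_id (0 : ℝ)).smul_const v).const_add x
    exact ((E C)ᗮ.starProjection.hasFDerivAt.comp_hasDerivAt (0 : ℝ) h2)
  have h3 := h1.norm_sq.sqrt (by simpa using hx0)
  simp only [Real.sqrt_sq (norm_nonneg _), zero_smul, add_zero] at h3
  convert h3 using 1
  rw [hu, inner_smul_left, inner_perp huC, norm_smul, norm_norm]
  have hu1 : ‖u‖ = 1 := by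
    have := congrArg norm hu
    rw [norm_smul, norm_norm] at this
    exact mul_left_cancel₀ hn (by rw [← this, mul_one])
  rw [hu1]
  simp only [conj_trivial]
  field_simp

end Perp

/-- A family of subspaces that is closed under intersections and satisfies an averaging
inequality: projecting to a member `E D` does not increase the sum of the distances to the members
that do not contain `E D`. -/
structure IsAveragingFamily [Fintype ι] (E : ι → Submodule ℝ W) : Prop where
  exists_inf : ∀ C D, ∃ K, E K = E C ⊓ E D
  sum_le : ∀ (D : ι) (x : W), open Classical in
    ∑ C with ¬ E D ≤ E C, ‖perp E C ((E D).starProjection x)‖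
      ≤ ∑ C with ¬ E D ≤ E C, ‖perp E C x‖

/-- A spherical blow-up of `W` along the subspaces `E C`: the blow-down map `q` and the continuous
unit normal directions `U C`, which extend `perp E C q / ‖perp E C q‖`. -/
structure IsSphericalBlowUp (E : ι → Submodule ℝ W) {B : Type*} [TopologicalSpace B]
    (q : B → W) (U : ι → B → W) : Prop where
  continuous_q : Continuous q
  continuous_U : ∀ C, Continuous (U C)
  norm_U : ∀ C b, ‖U C b‖ = 1
  U_mem : ∀ C b, U C b ∈ (E C)ᗮ
  perp_q : ∀ C b, perp E C (q b) = ‖perp E C (q b)‖ • U C b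
  dense_regular : Dense {b | ∀ C, q b ∉ E C}
  exists_regular : ∀ x, (∀ C, x ∉ E C) → ∃ b, q b = x
  ext : ∀ b b', q b = q b' → (∀ C, U C b = U C b') → b = b'
  isCompact_preimage : ∀ R : ℝ, IsCompact {b | ‖q b‖ ≤ R}

/-- The extension to the blow-up of the gradient of the convex function
`x ↦ ‖x‖ ^ 2 / 2 + ∑ C, ‖perp E C x‖`. -/
noncomputable def outward [Fintype ι] {B : Type*} (q : B → W) (U : ι → B → W) (b : B) : W :=
  q b + ∑ C, U C b

namespace IsSphericalBlowUp

variable {E : ι → Submodule ℝ W} {B : Type*} [TopologicalSpace B]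
    {q : B → W} {U : ι → B → W}

theorem inner_U_U (h : IsSphericalBlowUp E q U) (C : ι) (b : B) :
    inner ℝ (U C b) (U C b) = (1 : ℝ) := by
  rw [real_inner_self_eq_norm_sq, h.norm_U, one_pow]

theorem inner_U_q (h : IsSphericalBlowUp E q U) (C : ι) (b : B) :
    inner ℝ (U C b) (q b) = ‖perp E C (q b)‖ := by
  rw [← inner_perp (h.U_mem C b), h.perp_q, inner_smul_right, h.inner_U_U, norm_smul, norm_norm,
    h.norm_U]

theorem inner_U_le (h : IsSphericalBlowUp E q U) (C : ι) (b : B) (x : W) :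
    inner ℝ (U C b) x ≤ ‖perp E C x‖ := by
  rw [← inner_perp (h.U_mem C b)]
  simpa [h.norm_U] using real_inner_le_norm (U C b) (perp E C x)

theorem U_notMem (h : IsSphericalBlowUp E q U) (C : ι) (b : B) : U C b ∉ E C := by
  intro hm
  have := h.U_mem C b _ hm
  rw [h.inner_U_U] at this
  exact one_ne_zero this

/-- On a smaller subspace the normal direction determines, by projection, the normal directions
of the larger subspaces that do not contain it. -/
theorem perp_U (h : IsSphericalBlowUp E q U) {C D : ι} (hDC : E D ≤ E C) (b : B) :
    perp E C (U D b) = ‖perp E C (U D b)‖ • U C b := by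
  have hcl : IsClosed {b | perp E C (U D b) = ‖perp E C (U D b)‖ • U C b} := by
    have h1 : Continuous fun b => perp E C (U D b) :=
      (ContinuousLinearMap.continuous _).comp (h.continuous_U D)
    exact isClosed_eq h1 (h1.norm.smul (h.continuous_U C))
  refine hcl.closure_subset_iff.2 ?_ (h.dense_regular b)
  intro b hb
  have hr : 0 < ‖perp E D (q b)‖ :=
    norm_pos_iff.2 fun h0 => hb D (perp_eq_zero_iff.1 h0)
  have hU : U D b = ‖perp E D (q b)‖⁻¹ • perp E D (q b) := by
    conv_rhs => rw [h.perp_q D b, norm_smul, norm_norm, h.norm_U, mul_one]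
    rw [smul_smul, inv_mul_cancel₀ hr.ne', one_smul]
  have h2 : perp E C (U D b) = (‖perp E D (q b)‖⁻¹ * ‖perp E C (q b)‖) • U C b := by
    rw [hU, perp, map_smul]
    change _ • perp E C (perp E D (q b)) = _
    rw [perp_perp hDC, mul_smul, ← h.perp_q]
  change perp E C (U D b) = ‖perp E C (U D b)‖ • U C b
  rw [h2, norm_smul, h.norm_U, mul_one, Real.norm_of_nonneg (by positivity)]

variable [Fintype ι]

theorem continuous_outward (h : IsSphericalBlowUp E q U) : Continuous (outward q U) :=
  h.continuous_q.add (continuous_finsetSum _ fun C _ => h.continuous_U C)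

/-- As an extended gradient of a strongly convex function, `outward` determines the base point. Over
a given base point it determines the normal directions, from those at the small subspaces to those
at the large ones. -/
theorem outward_injective (hE : IsAveragingFamily E) (h : IsSphericalBlowUp E q U) :
    Function.Injective (outward q U) := by
  classical
  intro b b' hbb
  have hsum : ∀ x : W,
      inner ℝ (q b - q b') x + ∑ C, inner ℝ (U C b - U C b') x = 0 := by
    intro x
    rw [← sum_inner, ← inner_add_left, Finset.sum_sub_distrib]
    have : q b - q b' + (∑ C, U C b - ∑ C, U C b') = 0 := by
      rw [← sub_eq_zero] at hbb
      rw [← hbb, outward, outward]; abel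
    rw [this, inner_zero_left]
  have hq : q b = q b' := by
    have h0 := hsum (q b - q b')
    have h1 : 0 ≤ ∑ C, inner ℝ (U C b - U C b') (q b - q b') := by
      refine Finset.sum_nonneg fun C _ => ?_
      rw [← inner_perp (Submodule.sub_mem _ (h.U_mem C b) (h.U_mem C b')), perp, map_sub]
      change 0 ≤ inner ℝ _ (perp E C (q b) - perp E C (q b'))
      rw [h.perp_q C b, h.perp_q C b']
      exact inner_unit_sub_nonneg (h.norm_U C b) (h.norm_U C b') (norm_nonneg _) (norm_nonneg _)
    rw [real_inner_self_eq_norm_sq] at h0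
    have : ‖q b - q b'‖ ^ 2 = 0 := by nlinarith [sq_nonneg ‖q b - q b'‖]
    exact sub_eq_zero.1 (norm_eq_zero.1 (pow_eq_zero_iff two_ne_zero |>.1 this))
  refine h.ext b b' hq ?_
  by_contra! hne
  -- A differing direction whose subspace is as small as possible.
  obtain ⟨C₁, hC₁, hmin⟩ : ∃ C₁, U C₁ b ≠ U C₁ b' ∧
      ∀ K, E K ≤ E C₁ → U K b ≠ U K b' → E C₁ ≤ E K := by
    obtain ⟨V, ⟨C₁, hC₁, rfl⟩, hV⟩ :=
      (Set.toFinite (E '' {C | U C b ≠ U C b'})).exists_minimal (Set.Nonempty.image _ hne)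
    exact ⟨C₁, hC₁, fun K hK hKne => hV ⟨K, hKne, rfl⟩ hK⟩
  have h0 := hsum (U C₁ b - U C₁ b')
  rw [hq, sub_self, inner_zero_left, zero_add] at h0
  have hnn : ∀ C ∈ Finset.univ, 0 ≤ inner ℝ (U C b - U C b') (U C₁ b - U C₁ b') := by
    intro C _
    by_cases hC : E C₁ ≤ E C
    · rw [← inner_perp (Submodule.sub_mem _ (h.U_mem C b) (h.U_mem C b')), perp, map_sub]
      change 0 ≤ inner ℝ _ (perp E C (U C₁ b) - perp E C (U C₁ b'))
      rw [h.perp_U hC b, h.perp_U hC b']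
      exact inner_unit_sub_nonneg (h.norm_U C b) (h.norm_U C b') (norm_nonneg _) (norm_nonneg _)
    · obtain ⟨K, hK⟩ := hE.exists_inf C C₁
      have hKC : E K ≤ E C := hK.le.trans inf_le_left
      have hKC₁ : E K ≤ E C₁ := hK.le.trans inf_le_right
      have hUK : U K b = U K b' := by
        by_contra hh
        exact hC ((hmin K hKC₁ hh).trans hKC)
      -- The direction at `K` determines the one at each of `C`, `C₁` whose subspace misses it.
      have key : ∀ D, E K ≤ E D → U K b ∉ E D → U D b = U D b' := by
        intro D hD hnot
        have e1 := h.perp_U hD b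
        have e2 := h.perp_U hD b'
        rw [← hUK, e1] at e2
        have hpos : ‖perp E D (U K b)‖ ≠ 0 :=
          norm_ne_zero_iff.2 fun hz => hnot (perp_eq_zero_iff.1 hz)
        rw [norm_smul, norm_norm, h.norm_U, mul_one] at e2
        exact smul_right_injective W hpos e2
      have hin : U K b ∈ E C₁ := by
        by_contra hh
        exact hC₁ (key C₁ hKC₁ hh)
      have hout : U K b ∉ E C := by
        intro hh
        exact h.U_notMem K b (hK.ge ⟨hh, hin⟩)
      rw [key C hKC hout, sub_self, inner_zero_left]
  have := (Finset.sum_eq_zero_iff_of_nonneg hnn).1 h0 C₁ (Finset.mem_univ _)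
  exact hC₁ (sub_eq_zero.1 (inner_self_eq_zero.1 this))

open Classical in
/-- A lower bound for `outward` in the direction of the normals. At regular points the terms with
`¬ E D ≤ E C` contribute a nonnegative amount by convexity and the averaging inequality. -/
theorem sum_le_inner_outward (hE : IsAveragingFamily E) (h : IsSphericalBlowUp E q U) (D : ι)
    (b : B) : ∑ C with E D ≤ E C, ‖perp E C (U D b)‖ ≤ inner ℝ (outward q U b) (U D b) := by
  have hcl : IsClosed {b | ∑ C with E D ≤ E C, ‖perp E C (U D b)‖
      ≤ inner ℝ (outward q U b) (U D b)} := by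
    refine isClosed_le (continuous_finsetSum _ fun C _ => ?_)
      (h.continuous_outward.inner (h.continuous_U D))
    exact ((ContinuousLinearMap.continuous _).comp (h.continuous_U D)).norm
  refine hcl.closure_subset_iff.2 ?_ (h.dense_regular b)
  intro b hb
  have hr : 0 < ‖perp E D (q b)‖ :=
    norm_pos_iff.2 fun h0 => hb D (perp_eq_zero_iff.1 h0)
  refine le_of_mul_le_mul_left ?_ hr
  rw [← inner_smul_right, ← h.perp_q, Finset.mul_sum]
  have e0 : ∀ C, E D ≤ E C → ‖perp E D (q b)‖ * ‖perp E C (U D b)‖ = ‖perp E C (q b)‖ := by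
    intro C hC
    rw [← perp_perp hC (q b)]
    conv_rhs => rw [h.perp_q D b, perp, map_smul, norm_smul, norm_norm]
  rw [Finset.sum_congr rfl fun C hC => e0 C (Finset.mem_filter.1 hC).2, outward, inner_add_left,
    sum_inner, ← Finset.sum_filter_add_sum_filter_not Finset.univ fun C => E D ≤ E C]
  have e1 : ∀ C, inner ℝ (U C b) (perp E D (q b))
      = ‖perp E C (q b)‖ - inner ℝ (U C b) ((E D).starProjection (q b)) := by
    intro C
    rw [← h.inner_U_q, ← inner_sub_right]
    congr 1
    exact eq_sub_of_add_eq (perp_add_starProjection E D (q b))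
  have e2 : ∑ C with E D ≤ E C, ‖perp E C (q b)‖
      = ∑ C with E D ≤ E C, inner ℝ (U C b) (perp E D (q b)) := by
    refine Finset.sum_congr rfl fun C hC => ?_
    have hz : perp E C ((E D).starProjection (q b)) = 0 :=
      perp_eq_zero_iff.2 ((Finset.mem_filter.1 hC).2 (Submodule.starProjection_apply_mem _ _))
    rw [e1, ← inner_perp (h.U_mem C b) ((E D).starProjection (q b)), hz, inner_zero_right,
      sub_zero]
  have e3 : 0 ≤ ∑ C with ¬ E D ≤ E C, inner ℝ (U C b) (perp E D (q b)) := by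
    simp_rw [e1]
    rw [Finset.sum_sub_distrib, sub_nonneg]
    exact (Finset.sum_le_sum fun C _ => h.inner_U_le C b _).trans (hE.sum_le D (q b))
  have e4 : 0 ≤ inner ℝ (q b) (perp E D (q b)) := by
    rw [real_inner_comm, ← inner_perp (perp_mem E D (q b))]
    exact real_inner_self_nonneg
  rw [e2]
  linarith

theorem one_le_inner_outward (hE : IsAveragingFamily E) (h : IsSphericalBlowUp E q U) (D : ι)
    (b : B) : 1 ≤ inner ℝ (outward q U b) (U D b) := by
  classical
  refine le_trans ?_ (h.sum_le_inner_outward hE D b)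
  have h1 : ‖perp E D (U D b)‖ = 1 := by rw [perp_eq_self (h.U_mem D b), h.norm_U]
  rw [← h1]
  exact Finset.single_le_sum (f := fun C => ‖perp E C (U D b)‖) (fun C _ => norm_nonneg _)
    (Finset.mem_filter.2 ⟨Finset.mem_univ D, le_rfl⟩)

theorem outward_notMem (hE : IsAveragingFamily E) (h : IsSphericalBlowUp E q U) (D : ι)
    (b : B) : outward q U b ∉ E D := by
  intro hm
  have h1 := h.one_le_inner_outward hE D b
  rw [h.U_mem D b _ hm] at h1
  exact absurd h1 (by norm_num)

open Classical in
/-- An upper bound for `outward` in the directions normal to the smallest subspace that contains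
the base point. -/
theorem inner_outward_le_sum (hE : IsAveragingFamily E) (h : IsSphericalBlowUp E q U) {D : ι}
    {b : B} (hb : ∀ C, q b ∈ E C ↔ E D ≤ E C) {x : W} (hx : x ∈ (E D)ᗮ) :
    inner ℝ (outward q U b) x ≤ ∑ C with E D ≤ E C, ‖perp E C x‖ := by
  have hqD : q b ∈ E D := (hb D).2 le_rfl
  rw [outward, inner_add_left, hx _ hqD, zero_add, sum_inner,
    ← Finset.sum_filter_add_sum_filter_not Finset.univ fun C => E D ≤ E C]
  -- By the averaging inequality the remaining sum of norms is minimal at `q b` along `x`.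
  have hd : HasDerivAt (fun t : ℝ => ∑ C with ¬ E D ≤ E C, ‖perp E C (q b + t • x)‖)
      (∑ C with ¬ E D ≤ E C, inner ℝ (U C b) x) 0 := by
    refine HasDerivAt.fun_sum fun C hC => ?_
    exact hasDerivAt_norm_perp (h.perp_q C b) (h.U_mem C b)
      (fun hh => (Finset.mem_filter.1 hC).2 ((hb C).1 hh)) x
  have hmin : IsLocalMin (fun t : ℝ => ∑ C with ¬ E D ≤ E C, ‖perp E C (q b + t • x)‖) 0 := by
    refine Filter.Eventually.of_forall fun t => ?_
    have := hE.sum_le D (q b + t • x)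
    have hp : (E D).starProjection (q b + t • x) = q b := by
      rw [map_add, map_smul, Submodule.starProjection_eq_self_iff.2 hqD,
        (Submodule.starProjection_apply_eq_zero_iff (K := E D)).2 hx, smul_zero, add_zero]
    rw [hp] at this
    simpa using this
  rw [hmin.hasDerivAt_eq_zero hd, add_zero]
  exact Finset.sum_le_sum fun C _ => h.inner_U_le C b x

end IsSphericalBlowUp

end Arrangement

/-! ### The boundary of a spherical blow-up and the unit sphere -/

section Sphere

variable {W : Type*} [NormedAddCommGroup W] [InnerProductSpace ℝ W] [FiniteDimensional ℝ W]
  {ι : Type*} [Fintype ι]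

namespace IsSphericalBlowUp

variable {E : ι → Submodule ℝ W} {B : Type*} [TopologicalSpace B]
    {q : B → W} {U : ι → B → W}

theorem norm_outward_sub_le (h : IsSphericalBlowUp E q U) (b : B) :
    ‖outward q U b - q b‖ ≤ Fintype.card ι := by
  rw [outward, add_sub_cancel_left]
  refine (norm_sum_le _ _).trans ?_
  simp [h.norm_U]

/-- Every `y` close to a value of `outward` at a regular point is itself such a value: the proximal
point of `y` for the convex function `x ↦ ∑ C, ‖perp E C x‖` is then regular. -/
theorem exists_outward_eq (h : IsSphericalBlowUp E q U) {b₀ : B} {y : W}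
    (hy : ∀ p, ‖p - q b₀‖ ≤ 2 * ‖y - outward q U b₀‖ → ∀ C, p ∉ E C) :
    ∃ b, (∀ C, q b ∉ E C) ∧ outward q U b = y := by
  set ψ : W → ℝ := fun p => ‖p - y‖ ^ 2 / 2 + ∑ C, ‖perp E C p‖ with hψ
  have hcont : Continuous ψ := by
    refine (((continuous_id.sub continuous_const).norm.pow 2).div_const 2).add
      (continuous_finsetSum _ fun C _ => ?_)
    exact (ContinuousLinearMap.continuous _).norm
  have hsum0 : ∀ p : W, 0 ≤ ∑ C, ‖perp E C p‖ := fun p =>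
    Finset.sum_nonneg fun C _ => norm_nonneg _
  obtain ⟨p, hp⟩ : ∃ p, ∀ x, ψ p ≤ ψ x := by
    refine hcont.exists_forall_le' 0 ?_
    have h0 : 0 ≤ ψ 0 := add_nonneg (by positivity) (hsum0 0)
    filter_upwards [(tendsto_norm_cocompact_atTop (E := W)).eventually_ge_atTop
      (‖y‖ + 2 * ψ 0 + 1)] with x hx
    have h1 : 2 * ψ 0 + 1 ≤ ‖x - y‖ := by linarith [norm_sub_norm_le x y]
    have h2 : ‖x - y‖ ^ 2 / 2 ≤ ψ x := le_add_of_nonneg_right (hsum0 x)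
    nlinarith
  have hclose : ‖p - q b₀‖ ≤ 2 * ‖y - outward q U b₀‖ := by
    have h1 := hp (q b₀)
    have h2 : ∑ C, inner ℝ (U C b₀) p ≤ ∑ C, ‖perp E C p‖ :=
      Finset.sum_le_sum fun C _ => h.inner_U_le C b₀ p
    have h3 : ∑ C, ‖perp E C (q b₀)‖ = ∑ C, inner ℝ (U C b₀) (q b₀) :=
      Finset.sum_congr rfl fun C _ => (h.inner_U_q C b₀).symm
    simp only [hψ, h3] at h1
    have h4 : ‖p - y‖ ^ 2 = ‖p - q b₀‖ ^ 2 + 2 * inner ℝ (p - q b₀) (q b₀ - y)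
        + ‖q b₀ - y‖ ^ 2 := by
      rw [← norm_add_sq_real, sub_add_sub_cancel]
    have h5 : inner ℝ (p - q b₀) (y - outward q U b₀)
        = - inner ℝ (p - q b₀) (q b₀ - y)
          - (∑ C, inner ℝ (U C b₀) p - ∑ C, inner ℝ (U C b₀) (q b₀)) := by
      rw [← sum_inner, ← sum_inner, ← inner_sub_right, real_inner_comm (p - q b₀) (∑ C, U C b₀),
        ← inner_neg_right, ← inner_sub_right, outward]
      congr 1
      abel
    have h6 := real_inner_le_norm (p - q b₀) (y - outward q U b₀)
    by_contra! hlt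
    nlinarith [norm_nonneg (p - q b₀), norm_nonneg (y - outward q U b₀)]
  have hreg := hy p hclose
  obtain ⟨b, rfl⟩ := h.exists_regular p hreg
  refine ⟨b, hreg, ?_⟩
  have hstat : ∀ v : W, inner ℝ (outward q U b - y) v = 0 := by
    intro v
    have hd1 : HasDerivAt (fun t : ℝ => ‖q b + t • v - y‖ ^ 2 / 2) (inner ℝ (q b - y) v) 0 := by
      have h2 : HasDerivAt (fun t : ℝ => q b + t • v - y) v 0 := by
        simpa using (((hasDerivAt_id (0 : ℝ)).smul_const v).const_add (q b)).sub_const y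
      exact (h2.norm_sq.div_const 2).congr_deriv (by simp)
    have hd2 : HasDerivAt (fun t : ℝ => ∑ C, ‖perp E C (q b + t • v)‖)
        (∑ C, inner ℝ (U C b) v) 0 :=
      HasDerivAt.fun_sum fun C _ =>
        hasDerivAt_norm_perp (h.perp_q C b) (h.U_mem C b) (hreg C) v
    have hmin : IsLocalMin ((fun t : ℝ => ‖q b + t • v - y‖ ^ 2 / 2)
        + fun t : ℝ => ∑ C, ‖perp E C (q b + t • v)‖) 0 := by
      refine Filter.Eventually.of_forall fun t => ?_
      simpa [hψ] using hp (q b + t • v)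
    have := hmin.hasDerivAt_eq_zero (hd1.add hd2)
    rw [← sum_inner, ← inner_add_left] at this
    rw [← this, outward]
    congr 1
    abel
  exact sub_eq_zero.1 (inner_self_eq_zero.1 (hstat (outward q U b - y)))

/-- The points far out on a ray outside the arrangement are values of `outward` at regular
points. -/
theorem exists_outward_eq_smul (h : IsSphericalBlowUp E q U) {s : W} {r : ℝ} (hr : 0 < r)
    (hs : ∀ C, s ∉ E C) (hlarge : ∀ C, 2 * (Fintype.card ι : ℝ) < r * ‖perp E C s‖) :
    ∃ b, (∀ C, q b ∉ E C) ∧ outward q U b = r • s := by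
  obtain ⟨b₀, hb₀⟩ := h.exists_regular (r • s) fun C hC =>
    hs C (((E C).smul_mem_iff hr.ne').1 hC)
  refine h.exists_outward_eq (b₀ := b₀) fun p hp C hpC => ?_
  have h1 := h.norm_outward_sub_le b₀
  rw [hb₀] at hp h1
  rw [norm_sub_rev] at h1
  have h2 : ‖perp E C (p - r • s)‖ = r * ‖perp E C s‖ := by
    rw [perp, map_sub, map_smul, show (E C)ᗮ.starProjection p = 0 from perp_eq_zero_iff.2 hpC,
      zero_sub, norm_neg, norm_smul, Real.norm_of_nonneg hr.le]
  have h3 := norm_perp_le E C (p - r • s)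
  have h4 := hlarge C
  linarith

theorem isProperMap_outward (h : IsSphericalBlowUp E q U) : IsProperMap (outward q U) := by
  refine isProperMap_iff_isCompact_preimage.2 ⟨h.continuous_outward, fun K hK => ?_⟩
  obtain ⟨R, hR⟩ := hK.isBounded.exists_norm_le
  refine (h.isCompact_preimage (R + Fintype.card ι)).of_isClosed_subset
    (hK.isClosed.preimage h.continuous_outward) fun b hb => ?_
  have h1 := hR _ hb
  have h2 := h.norm_outward_sub_le b
  have h3 := norm_sub_le (outward q U b) (outward q U b - q b)
  rw [sub_sub_cancel] at h3
  exact h3.trans (add_le_add h1 h2)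

/-- Among the members of the family that contain a given point there is a smallest one. -/
theorem exists_smallest (hE : IsAveragingFamily E) {x : W} (hx : ∃ C, x ∈ E C) :
    ∃ D, ∀ C, x ∈ E C ↔ E D ≤ E C := by
  obtain ⟨V, ⟨D, hD, rfl⟩, hV⟩ :=
    (Set.toFinite (E '' {C | x ∈ E C})).exists_minimal (Set.Nonempty.image _ hx)
  refine ⟨D, fun C => ⟨fun hC => ?_, fun hC => hC hD⟩⟩
  obtain ⟨K, hK⟩ := hE.exists_inf C D
  have hKD := hV ⟨K, hK.ge ⟨hC, hD⟩, rfl⟩ (hK.le.trans inf_le_right)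
  exact hKD.trans (hK.le.trans inf_le_left)

/-- The image of the singular points is not met again further out on a ray. -/
theorem le_one_of_outward_eq_smul (hE : IsAveragingFamily E) (h : IsSphericalBlowUp E q U)
    {b b' : B} (hb : ∃ C, q b ∈ E C) {r : ℝ}
    (hbb : outward q U b = r • outward q U b') : r ≤ 1 := by
  classical
  obtain ⟨D, hD⟩ := exists_smallest hE hb
  have h1 := h.sum_le_inner_outward hE D b'
  have h2 := h.inner_outward_le_sum hE hD (h.U_mem D b')
  have h3 := h.one_le_inner_outward hE D b'
  rw [hbb, inner_smul_left, conj_trivial] at h2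
  by_contra! hlt
  nlinarith

theorem one_le_norm_outward [Nonempty ι] (hE : IsAveragingFamily E)
    (h : IsSphericalBlowUp E q U) (b : B) : 1 ≤ ‖outward q U b‖ := by
  obtain ⟨D⟩ := ‹Nonempty ι›
  have h1 := real_inner_le_norm (outward q U b) (U D b)
  rw [h.norm_U, mul_one] at h1
  exact (h.one_le_inner_outward hE D b).trans h1

theorem isOpen_regular (E : ι → Submodule ℝ W) : IsOpen {x | ∀ C, x ∉ E C} := by
  simp only [Set.ofPred_forall]
  exact isOpen_iInter_of_finite fun C => (E C).closed_of_finiteDimensional.isOpen_compl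

theorem exists_singular_outward_eq_smul [Nonempty ι] (hE : IsAveragingFamily E)
    (h : IsSphericalBlowUp E q U) {s : W} (hs1 : ‖s‖ = 1) (hs : ∀ C, s ∉ E C) :
    ∃ r : ℝ, 0 < r ∧ ∃ b, (∃ C, q b ∈ E C) ∧ outward q U b = r • s := by
  set S : Set ℝ := {r | 0 ≤ r ∧ r • s ∈ Set.range (outward q U)} with hS
  have hclosed : IsClosed S := by
    refine IsClosed.and isClosed_Ici ?_
    exact h.isProperMap_outward.isClosedMap.isClosed_range.preimage
      (continuous_id.smul continuous_const)
  have hbdd : BddBelow S := ⟨0, fun r hr => hr.1⟩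
  have hne : S.Nonempty := by
    have hpos : ∀ C, 0 < ‖perp E C s‖ := fun C =>
      norm_pos_iff.2 fun h0 => hs C (perp_eq_zero_iff.1 h0)
    set r : ℝ := 1 + ∑ C, 2 * (Fintype.card ι : ℝ) / ‖perp E C s‖ with hr
    have hr0 : 0 < r := by
      have : 0 ≤ ∑ C, 2 * (Fintype.card ι : ℝ) / ‖perp E C s‖ :=
        Finset.sum_nonneg fun C _ => by positivity
      linarith
    obtain ⟨b, -, hb⟩ := h.exists_outward_eq_smul hr0 hs fun C => by
      rw [← div_lt_iff₀ (hpos C)]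
      have := Finset.single_le_sum (f := fun C => 2 * (Fintype.card ι : ℝ) / ‖perp E C s‖)
        (fun C _ => by positivity) (Finset.mem_univ C)
      linarith
    exact ⟨r, hr0.le, b, hb⟩
  obtain ⟨hr0, b, hb⟩ := hclosed.csInf_mem hne hbdd
  have hr1 : 1 ≤ sInf S := by
    have := h.one_le_norm_outward hE b
    rwa [hb, norm_smul, hs1, mul_one, Real.norm_of_nonneg hr0] at this
  refine ⟨sInf S, by linarith, b, ?_, hb⟩
  -- At a regular point the ray could be followed a little further inwards.
  by_contra! hreg
  obtain ⟨ε, hε, hball⟩ := Metric.isOpen_iff.1 (isOpen_regular E) (q b) hreg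
  set η : ℝ := min (ε / 4) 1 with hη
  have hη0 : 0 < η := lt_min (by linarith) one_pos
  obtain ⟨b', -, hb'⟩ := h.exists_outward_eq (b₀ := b) (y := (sInf S - η) • s) (by
    intro p hp
    refine hball ?_
    rw [hb, ← sub_smul, norm_smul, hs1, mul_one, sub_sub_cancel_left, norm_neg,
      Real.norm_of_nonneg hη0.le] at hp
    rw [Metric.mem_ball, dist_eq_norm]
    linarith [min_le_left (ε / 4) 1])
  have := csInf_le hbdd (show sInf S - η ∈ S from
    ⟨by linarith [min_le_right (ε / 4) 1], b', hb'⟩)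
  linarith

/-- Radial projection of `outward` identifies the singular points of the blow-up with the
complement of the arrangement in the unit sphere. -/
theorem nonempty_homeomorph [Nonempty ι] (hE : IsAveragingFamily E)
    (h : IsSphericalBlowUp E q U) :
    Nonempty ({b // ∃ C, q b ∈ E C} ≃ₜ {s : W // ‖s‖ = 1 ∧ ∀ C, s ∉ E C}) := by
  have hn1 := h.one_le_norm_outward hE
  have hn0 : ∀ b, 0 < ‖outward q U b‖ := fun b => one_pos.trans_le (hn1 b)
  set f : {b // ∃ C, q b ∈ E C} → {s : W // ‖s‖ = 1 ∧ ∀ C, s ∉ E C} := fun b =>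
    ⟨‖outward q U b.1‖⁻¹ • outward q U b.1, by
      rw [norm_smul, norm_inv, norm_norm, inv_mul_cancel₀ (hn0 _).ne'], fun C hC =>
      h.outward_notMem hE C b.1 (((E C).smul_mem_iff (inv_ne_zero (hn0 _).ne')).1 hC)⟩ with hf
  have hfval : ∀ b, outward q U b.1 = ‖outward q U b.1‖ • (f b).1 := fun b => by
    rw [hf, smul_smul, mul_inv_cancel₀ (hn0 _).ne', one_smul]
  have hcont : Continuous f := by
    have h1 : Continuous fun b : {b // ∃ C, q b ∈ E C} => outward q U b.1 :=
      h.continuous_outward.comp continuous_subtype_val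
    exact ((h1.norm.inv₀ fun b => (hn0 _).ne').smul h1).subtype_mk _
  have hinj : Function.Injective f := by
    have key : ∀ b b', f b = f b' → ‖outward q U b.1‖ ≤ ‖outward q U b'.1‖ := by
      intro b b' hbb
      have h1 : outward q U b.1 = (‖outward q U b.1‖ / ‖outward q U b'.1‖) • outward q U b'.1 := by
        conv_lhs => rw [hfval b, hbb]
        conv_rhs => rw [hfval b', norm_smul, norm_norm, (f b').2.1, mul_one, smul_smul,
          div_mul_cancel₀ _ (hn0 _).ne']
      have := h.le_one_of_outward_eq_smul hE b.2 h1
      rwa [div_le_one (hn0 _)] at this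
    intro b b' hbb
    refine Subtype.ext (h.outward_injective hE ?_)
    rw [hfval b, hfval b', hbb, le_antisymm (key b b' hbb) (key b' b hbb.symm)]
  have hsurj : Function.Surjective f := by
    rintro ⟨s, hs1, hs⟩
    obtain ⟨r, hr, b, hb, hbs⟩ := h.exists_singular_outward_eq_smul hE hs1 hs
    refine ⟨⟨b, hb⟩, Subtype.ext ?_⟩
    simp only [hf, hbs, norm_smul, hs1, mul_one, Real.norm_of_nonneg hr.le, smul_smul,
      inv_mul_cancel₀ hr.ne', one_smul]
  have hsing : IsClosed {b | ∃ C, q b ∈ E C} := by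
    have := ((isOpen_regular E).preimage h.continuous_q).isClosed_compl
    convert this using 1
    ext b
    simp
  have hproper : IsProperMap f := by
    refine isProperMap_iff_isCompact_preimage.2 ⟨hcont, fun K hK => ?_⟩
    -- On `K` the distances to the arrangement are bounded below, and at a singular point
    -- `outward` is bounded in terms of them.
    have hc : ContinuousOn (fun s : {s : W // ‖s‖ = 1 ∧ ∀ C, s ∉ E C} =>
        ∑ C, ‖perp E C s.1‖⁻¹) K := by
      refine (continuous_finsetSum _ fun C _ => ?_).continuousOn
      refine (((ContinuousLinearMap.continuous _).comp continuous_subtype_val).norm).inv₀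
        fun s => norm_ne_zero_iff.2 fun h0 => s.2.2 C (perp_eq_zero_iff.1 h0)
    obtain ⟨R, hR⟩ := hK.exists_bound_of_continuousOn hc
    have hbound : ∀ b ∈ f ⁻¹' K, ‖outward q U b.1‖ ≤ 2 * Fintype.card ι * R := by
      intro b hb
      obtain ⟨C, hC⟩ : ∃ C, ‖outward q U b.1‖ * ‖perp E C (f b).1‖ ≤ 2 * Fintype.card ι := by
        by_contra! hlarge
        obtain ⟨b', hb', hbb'⟩ := h.exists_outward_eq_smul (hn0 b.1) (f b).2.2 hlarge
        rw [← hfval b] at hbb'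
        obtain ⟨C, hC⟩ := b.2
        exact hb' C (by rwa [h.outward_injective hE hbb'])
      have hpos : 0 < ‖perp E C (f b).1‖ :=
        norm_pos_iff.2 fun h0 => (f b).2.2 C (perp_eq_zero_iff.1 h0)
      have h1 : ‖perp E C (f b).1‖⁻¹ ≤ R := by
        refine le_trans ?_ ((le_abs_self _).trans (hR _ hb))
        exact Finset.single_le_sum (f := fun C => ‖perp E C (f b).1‖⁻¹)
          (fun C _ => inv_nonneg.2 (norm_nonneg _)) (Finset.mem_univ C)
      rw [← le_div_iff₀ hpos] at hC
      refine hC.trans ?_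
      rw [div_eq_mul_inv]
      exact mul_le_mul_of_nonneg_left h1 (by positivity)
    rw [Subtype.isCompact_iff]
    refine (h.isProperMap_outward.isCompact_preimage
      (isCompact_closedBall (0 : W) (2 * Fintype.card ι * R))).of_isClosed_subset
      (hsing.isClosedEmbedding_subtypeVal.isClosedMap _ (hK.isClosed.preimage hcont)) ?_
    rintro _ ⟨b, hb, rfl⟩
    simpa using hbound b hb
  exact ⟨(Equiv.ofBijective f ⟨hinj, hsurj⟩).toHomeomorphOfContinuousClosed hcont
    hproper.isClosedMap⟩

end IsSphericalBlowUp

end Sphere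

/-! ### Cluster partitions and their equivalence relations -/

section Partition

variable {n : ℕ}

theorem exists_part_eq_iff (r : Setoid (Fin n)) :
    ∃ C : ClusterPartition n, ∀ i j, C.part i = C.part j ↔ r i j := by
  classical
  refine ⟨Finpartition.ofSetoid r, fun i j => ?_⟩
  rw [← Finpartition.mem_part_iff_part_eq_part _ (Finset.mem_univ i) (Finset.mem_univ j),
    Finpartition.mem_part_ofSetoid_iff_rel]
  exact ⟨Setoid.symm, Setoid.symm⟩

theorem le_of_part_eq {C D : ClusterPartition n}
    (h : ∀ i j, C.part i = C.part j → D.part i = D.part j) : C ≤ D := by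
  intro A hA
  obtain ⟨a, ha⟩ := C.nonempty_of_mem_parts hA
  refine ⟨D.part a, D.part_mem.2 (Finset.mem_univ a), fun i hi => ?_⟩
  rw [Finpartition.mem_part_iff_part_eq_part _ (Finset.mem_univ i) (Finset.mem_univ a)]
  exact h i a (by rw [C.part_eq_of_mem hA hi, C.part_eq_of_mem hA ha])

theorem eq_of_part_eq_iff {C D : ClusterPartition n}
    (h : ∀ i j, C.part i = C.part j ↔ D.part i = D.part j) : C = D :=
  le_antisymm (le_of_part_eq fun i j => (h i j).1) (le_of_part_eq fun i j => (h i j).2)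

theorem part_bot (i : Fin n) : (⊥ : ClusterPartition n).part i = {i} :=
  Finpartition.part_eq_of_mem _ (Finpartition.mem_bot_iff.2 ⟨i, Finset.mem_univ i, rfl⟩)
    (Finset.mem_singleton_self i)

theorem ne_bot_iff {C : ClusterPartition n} :
    C ≠ ⊥ ↔ ∃ i j, i ≠ j ∧ C.part i = C.part j := by
  constructor
  · intro hC
    by_contra! h
    refine hC (eq_of_part_eq_iff fun i j => ⟨fun hij => ?_, fun hij => ?_⟩)
    · by_contra hne
      exact h i j (fun e => hne (by rw [e])) hij
    · rw [part_bot, part_bot, Finset.singleton_inj] at hij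
      rw [hij]
  · rintro ⟨i, j, hij, h⟩ rfl
    rw [part_bot, part_bot, Finset.singleton_inj] at h
    exact hij h

theorem exists_collisionPartition {r : Setoid (Fin n)} {i j : Fin n} (hij : i ≠ j)
    (h : r i j) : ∃ C : CollisionPartition n, ∀ i j, C.1.part i = C.1.part j ↔ r i j := by
  obtain ⟨C, hC⟩ := exists_part_eq_iff r
  exact ⟨⟨C, ne_bot_iff.2 ⟨i, j, hij, (hC i j).2 h⟩⟩, hC⟩

theorem card_parts_lt (C : CollisionPartition n) : C.1.parts.card < n := by
  obtain ⟨i, j, hij, h⟩ := ne_bot_iff.1 C.2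
  have himg : C.1.parts ⊆ (Finset.univ.erase i).image C.1.part := by
    intro A hA
    obtain ⟨a, ha⟩ := C.1.nonempty_of_mem_parts hA
    have hAa := C.1.part_eq_of_mem hA ha
    by_cases hai : a = i
    · exact Finset.mem_image.2 ⟨j, by simp [hij.symm], by rw [← h, ← hai, hAa]⟩
    · exact Finset.mem_image.2 ⟨a, by simp [hai], hAa⟩
  have h1 := (Finset.card_le_card himg).trans Finset.card_image_le
  rw [Finset.card_erase_of_mem (Finset.mem_univ i), Finset.card_univ, Fintype.card_fin] at h1
  have := i.pos
  omega

end Partition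

/-! ### The collision arrangement for equal masses -/

section EqualMass

variable {n d : ℕ}

variable (n d) in
/-- The subspace of the centre of mass zero configurations of `n` particles of mass one. -/
def centredSubmodule : Submodule ℝ (PiLp 2 fun _ : Fin n => EuclideanSpace ℝ (Fin d)) where
  carrier := {y | ∑ i, y i = 0}
  zero_mem' := by simp
  add_mem' := by
    intro x y hx hy
    simp only [Set.mem_ofPred_eq, PiLp.add_apply, Finset.sum_add_distrib] at *
    rw [hx, hy, add_zero]
  smul_mem' := by
    intro c y hy
    simp only [Set.mem_ofPred_eq, PiLp.smul_apply, ← Finset.smul_sum] at *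
    rw [hy, smul_zero]

variable (n d) in
/-- The centre of mass zero configurations of `n` particles of mass one in `ℝ^d`, as a Euclidean
space. A type of its own, so that its only linear structure is that of the normed space. -/
def CentredConf : Type := centredSubmodule n d

noncomputable instance : NormedAddCommGroup (CentredConf n d) :=
  inferInstanceAs (NormedAddCommGroup (centredSubmodule n d))

noncomputable instance : InnerProductSpace ℝ (CentredConf n d) :=
  inferInstanceAs (InnerProductSpace ℝ (centredSubmodule n d))

instance : FiniteDimensional ℝ (CentredConf n d) :=
  inferInstanceAs (FiniteDimensional ℝ (centredSubmodule n d))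

namespace CentredConf

/-- The position of the `i`-th particle. -/
noncomputable def coord (i : Fin n) : CentredConf n d →ₗ[ℝ] EuclideanSpace ℝ (Fin d) where
  toFun y := y.1 i
  map_add' _ _ := rfl
  map_smul' _ _ := rfl

theorem ext {x y : CentredConf n d} (h : ∀ i, coord i x = coord i y) : x = y :=
  Subtype.ext (PiLp.ext h)

/-- The configuration with given positions. -/
def mk (f : Fin n → EuclideanSpace ℝ (Fin d)) (hf : ∑ i, f i = 0) : CentredConf n d :=
  ⟨WithLp.toLp 2 f, hf⟩

theorem sum_coord (y : CentredConf n d) : ∑ i, coord i y = 0 := y.2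

theorem inner_def (x y : CentredConf n d) :
    inner ℝ x y = ∑ i, inner ℝ (coord i x) (coord i y) := rfl

end CentredConf

open CentredConf

variable (d) in
/-- The collision subspace of a partition, in the equal mass configuration space. -/
def coincide (C : CollisionPartition n) : Submodule ℝ (CentredConf n d) where
  carrier := {y | ∀ i j, C.1.part i = C.1.part j → coord i y = coord j y}
  zero_mem' := by intro i j _; rfl
  add_mem' := by
    intro x y hx hy i j hij
    simp [hx i j hij, hy i j hij]
  smul_mem' := by
    intro c y hy i j hij
    simp [hy i j hij]

theorem mem_coincide {C : CollisionPartition n} {y : CentredConf n d} :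
    y ∈ coincide d C ↔ ∀ i j, C.1.part i = C.1.part j → coord i y = coord j y := Iff.rfl

/-- Relabelling of the particles. -/
noncomputable def permute (σ : Equiv.Perm (Fin n)) : CentredConf n d →ₗ[ℝ] CentredConf n d where
  toFun y := CentredConf.mk (fun i => coord (σ i) y) <| by
    rw [Equiv.sum_comp σ fun i => coord i y, sum_coord]
  map_add' x y := rfl
  map_smul' c y := rfl

@[simp] theorem permute_apply (σ : Equiv.Perm (Fin n)) (y : CentredConf n d) (i : Fin n) :
    coord i (permute σ y) = coord (σ i) y := rfl

theorem inner_permute (σ : Equiv.Perm (Fin n)) (x y : CentredConf n d) :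
    inner ℝ (permute σ x) (permute σ y) = inner ℝ x y := by
  simp only [inner_def, permute_apply]
  exact Equiv.sum_comp σ fun i => inner ℝ (coord i x) (coord i y)

theorem norm_permute (σ : Equiv.Perm (Fin n)) (x : CentredConf n d) : ‖permute σ x‖ = ‖x‖ := by
  rw [norm_eq_sqrt_real_inner, norm_eq_sqrt_real_inner, inner_permute]

theorem permute_permute_symm (σ : Equiv.Perm (Fin n)) (x : CentredConf n d) :
    permute σ (permute σ⁻¹ x) = x := by
  refine CentredConf.ext fun i => ?_
  simp

/-- Relabelling the particles permutes the collision partitions. -/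
theorem exists_perm_partition (σ : Equiv.Perm (Fin n)) :
    ∃ τ : Equiv.Perm (CollisionPartition n), ∀ (C : CollisionPartition n) (i j : Fin n),
      (τ C).1.part (σ i) = (τ C).1.part (σ j) ↔ C.1.part i = C.1.part j := by
  have h : ∀ C : CollisionPartition n, ∃ D : CollisionPartition n, ∀ i j : Fin n,
      D.1.part (σ i) = D.1.part (σ j) ↔ C.1.part i = C.1.part j := by
    intro C
    obtain ⟨i, j, hij, hC⟩ := ne_bot_iff.1 C.2
    obtain ⟨D, hD⟩ := exists_collisionPartition
      (r := Setoid.ker fun k => C.1.part (σ.symm k)) (σ.injective.ne hij)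
      (by simpa [Setoid.ker_def] using hC)
    exact ⟨D, fun i j => by rw [hD]; simp [Setoid.ker_def]⟩
  choose τ hτ using h
  have hinj : Function.Injective τ := fun C D hCD =>
    Subtype.ext (eq_of_part_eq_iff fun i j => by rw [← hτ C, ← hτ D, hCD])
  exact ⟨Equiv.ofBijective τ (Finite.injective_iff_bijective.1 hinj), hτ⟩

theorem permute_mem_coincide_iff {σ : Equiv.Perm (Fin n)} {C D : CollisionPartition n}
    (h : ∀ i j, D.1.part (σ i) = D.1.part (σ j) ↔ C.1.part i = C.1.part j) {y : CentredConf n d} :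
    permute σ y ∈ coincide d C ↔ y ∈ coincide d D := by
  simp only [mem_coincide, permute_apply, ← h]
  constructor
  · intro H i j hij
    simpa using H (σ.symm i) (σ.symm j) (by simpa using hij)
  · exact fun H i j hij => H _ _ hij

theorem norm_perp_permute {σ : Equiv.Perm (Fin n)} {C D : CollisionPartition n}
    (h : ∀ i j, D.1.part (σ i) = D.1.part (σ j) ↔ C.1.part i = C.1.part j) (y : CentredConf n d) :
    ‖perp (coincide d) C (permute σ y)‖ = ‖perp (coincide d) D y‖ := by
  have h1 : permute σ y = permute σ (perp (coincide d) D y)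
      + permute σ ((coincide d D).starProjection y) := by
    rw [← map_add, perp_add_starProjection]
  have h2 : permute σ (perp (coincide d) D y) ∈ (coincide d C)ᗮ := by
    intro w hw
    rw [← permute_permute_symm σ w, inner_permute]
    refine perp_mem (coincide d) D y _ ?_
    rw [← permute_mem_coincide_iff h, permute_permute_symm]
    exact hw
  have h3 : permute σ ((coincide d D).starProjection y)
      ∈ coincide d C := by
    rw [permute_mem_coincide_iff h]
    exact Submodule.starProjection_apply_mem _ _
  rw [perp_of_eq_add h2 h3 h1, norm_permute]

theorem permute_eq_self {σ : Equiv.Perm (Fin n)} {D : CollisionPartition n}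
    (hσ : ∀ i, D.1.part (σ i) = D.1.part i) {y : CentredConf n d} (hy : y ∈ coincide d D) :
    permute σ y = y :=
  CentredConf.ext fun i => hy _ _ (hσ i)

open Classical in
/-- The projection to a collision subspace is the average over the relabellings that preserve the
clusters. -/
theorem starProjection_coincide (D : CollisionPartition n) (x : CentredConf n d)
    {G : Finset (Equiv.Perm (Fin n))} (hG : ∀ σ, σ ∈ G ↔ ∀ i, D.1.part (σ i) = D.1.part i) :
    (coincide d D).starProjection x = (G.card : ℝ)⁻¹ • ∑ σ ∈ G, permute σ x := by
  have hcard : (G.card : ℝ) ≠ 0 :=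
    Nat.cast_ne_zero.2 (Finset.card_ne_zero_of_mem ((hG 1).2 fun i => rfl))
  have happ : ∀ i, coord i (∑ σ ∈ G, permute σ x) = ∑ σ ∈ G, coord (σ i) x := by
    intro i
    rw [map_sum]
    rfl
  refine Submodule.eq_starProjection_of_mem_of_inner_eq_zero ?_ ?_
  · refine Submodule.smul_mem _ _ fun i j hij => ?_
    rw [happ, happ]
    refine Finset.sum_equiv (Equiv.mulRight (Equiv.swap i j)) ?_ ?_
    · have hsw : ∀ k, D.1.part (Equiv.swap i j k) = D.1.part k := by
        intro k
        rcases eq_or_ne k i with rfl | hki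
        · rw [Equiv.swap_apply_left, hij]
        · rcases eq_or_ne k j with rfl | hkj
          · rw [Equiv.swap_apply_right, hij]
          · rw [Equiv.swap_apply_of_ne_of_ne hki hkj]
      intro σ
      rw [hG, hG]
      constructor
      · intro h k
        simp only [Equiv.coe_mulRight, Equiv.Perm.mul_apply]
        rw [h, hsw]
      · intro h k
        have := h (Equiv.swap i j k)
        simpa [hsw] using this
    · intro σ _
      simp
  · intro w hw
    rw [inner_sub_left, real_inner_smul_left, sum_inner, Finset.sum_congr rfl fun σ hσ => by
      rw [← permute_eq_self ((hG σ).1 hσ) hw, inner_permute],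
      Finset.sum_const, nsmul_eq_mul, inv_mul_cancel_left₀ hcard, sub_self]

theorem isAveragingFamily_coincide : IsAveragingFamily (coincide (n := n) d) where
  exists_inf C D := by
    obtain ⟨i, j, hij, hC⟩ := ne_bot_iff.1 C.2
    obtain ⟨K, hK⟩ := exists_collisionPartition
      (r := Setoid.ker C.1.part ⊔ Setoid.ker D.1.part) hij
      ((le_sup_left : Setoid.ker C.1.part ≤ _) hC)
    refine ⟨K, le_antisymm ?_ ?_⟩
    · exact fun y hy =>
        ⟨fun i j h => hy i j ((hK i j).2 ((le_sup_left : Setoid.ker C.1.part ≤ _) h)),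
          fun i j h => hy i j ((hK i j).2 ((le_sup_right : Setoid.ker D.1.part ≤ _) h))⟩
    · intro y hy
      have hle : Setoid.ker C.1.part ⊔ Setoid.ker D.1.part ≤ Setoid.ker fun i => coord i y :=
        sup_le (fun {i j} h => hy.1 i j h) (fun {i j} h => hy.2 i j h)
      exact fun i j h => hle ((hK i j).1 h)
  sum_le D x := by
    classical
    set G : Finset (Equiv.Perm (Fin n)) :=
      Finset.univ.filter fun σ => ∀ i, D.1.part (σ i) = D.1.part i with hG
    have hG' : ∀ σ, σ ∈ G ↔ ∀ i, D.1.part (σ i) = D.1.part i := fun σ => by simp [hG]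
    have hcard : (0 : ℝ) < G.card :=
      Nat.cast_pos.2 (Finset.card_pos.2 ⟨1, (hG' 1).2 fun i => rfl⟩)
    set s : ℝ := ∑ C with ¬ coincide d D ≤ coincide d C, ‖perp (coincide d) C x‖ with hs
    have hperm : ∀ σ ∈ G, ∑ C with ¬ coincide d D ≤ coincide d C,
        ‖perp (coincide d) C (permute σ x)‖ = s := by
      intro σ hσ
      obtain ⟨τ, hτ⟩ := exists_perm_partition σ
      refine Finset.sum_equiv τ (fun C => ?_) fun C _ => norm_perp_permute (hτ C) x
      simp only [Finset.mem_filter, Finset.mem_univ, true_and, not_iff_not]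
      refine forall₂_congr fun y hy => ?_
      rw [← permute_mem_coincide_iff (hτ C), permute_eq_self ((hG' σ).1 hσ) hy]
    rw [starProjection_coincide D x hG']
    calc ∑ C with ¬ coincide d D ≤ coincide d C,
          ‖perp (coincide d) C ((G.card : ℝ)⁻¹ • ∑ σ ∈ G, permute σ x)‖
        ≤ ∑ C with ¬ coincide d D ≤ coincide d C,
          (G.card : ℝ)⁻¹ * ∑ σ ∈ G, ‖perp (coincide d) C (permute σ x)‖ := by
          refine Finset.sum_le_sum fun C _ => ?_
          rw [perp, map_smul, map_sum, norm_smul, Real.norm_of_nonneg (by positivity)]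
          exact mul_le_mul_of_nonneg_left (norm_sum_le _ _) (by positivity)
      _ = (G.card : ℝ)⁻¹ * ∑ σ ∈ G, s := by
          rw [← Finset.mul_sum, Finset.sum_comm, Finset.sum_congr rfl hperm]
      _ = s := by
          rw [Finset.sum_const, nsmul_eq_mul, inv_mul_cancel_left₀ hcard.ne']

end EqualMass

/-! ### Orthogonal decompositions for the mass inner product -/

section Mass

variable {n d : ℕ} {m : Fin n → ℝ}

theorem massInner_comm (p q : Conf d m) : massInner p q = massInner q p := by
  unfold massInner
  exact Finset.sum_congr rfl fun i _ => by rw [real_inner_comm]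

theorem inertia_add (p q : Conf d m) :
    inertia (p + q) = inertia p + 2 * massInner p q + inertia q := by
  unfold inertia
  rw [massInner_add_right, massInner_comm (p + q) p, massInner_comm (p + q) q,
    massInner_add_right, massInner_add_right, massInner_comm q p]
  ring

theorem projE_add_projI (hm : ∀ i, 0 < m i) (C : ClusterPartition n) (q : Conf d m) :
    projE hm C q + projI hm C q = q := add_sub_cancel _ _

theorem inertia_eq_add (hm : ∀ i, 0 < m i) (C : ClusterPartition n) (q : Conf d m) :
    inertia q = inertia (projE hm C q) + inertia (projI hm C q) := by
  conv_lhs => rw [← projE_add_projI hm C q]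
  rw [inertia_add, projI_mem hm C q _ (projE_mem hm C q)]
  ring

theorem eq_zero_of_mem_external_of_mem_internal (hm : ∀ i, 0 < m i) {C : ClusterPartition n}
    {x : Conf d m} (hE : x ∈ external d m C) (hI : x ∈ internal d m C) : x = 0 := by
  by_contra hx
  exact (inertia_pos hm hx).ne' (hI x hE)

theorem projE_eq_of_eq_add (hm : ∀ i, 0 < m i) {C : ClusterPartition n} {q e x : Conf d m}
    (he : e ∈ external d m C) (hx : x ∈ internal d m C) (hq : e + x = q) :
    projE hm C q = e := by
  have h1 : projE hm C q - e = x - projI hm C q := by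
    rw [sub_eq_sub_iff_add_eq_add, projE_add_projI, ← hq, add_comm]
  refine sub_eq_zero.1 (eq_zero_of_mem_external_of_mem_internal hm
    (Submodule.sub_mem _ (projE_mem hm C q) he) ?_)
  rw [h1]
  exact Submodule.sub_mem _ hx (projI_mem hm C q)

theorem projI_eq_zero (hm : ∀ i, 0 < m i) {C : ClusterPartition n} {q : Conf d m}
    (hq : q ∈ external d m C) : projI hm C q = 0 := by
  rw [projI, projE_eq_of_eq_add hm hq (Submodule.zero_mem _) (add_zero q), sub_self]

theorem projE_smul (hm : ∀ i, 0 < m i) (C : ClusterPartition n) (t : ℝ) (q : Conf d m) :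
    projE hm C (t • q) = t • projE hm C q :=
  projE_eq_of_eq_add hm (Submodule.smul_mem _ t (projE_mem hm C q))
    (Submodule.smul_mem _ t (projI_mem hm C q)) (by rw [← smul_add, projE_add_projI])

theorem projI_smul (hm : ∀ i, 0 < m i) (C : ClusterPartition n) (t : ℝ) (q : Conf d m) :
    projI hm C (t • q) = t • projI hm C q := by
  rw [projI, projI, projE_smul, smul_sub]

theorem continuous_position (i : Fin n) :
    Continuous fun q : Conf d m => (q.1 i : EuclideanSpace ℝ (Fin d)) :=
  (continuous_apply i).comp continuous_subtype_val

theorem continuous_projE (hm : ∀ i, 0 < m i) (C : ClusterPartition n) :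
    Continuous (projE (d := d) hm C) := by
  refine Continuous.subtype_mk (continuous_pi fun i => ?_) _
  have hs : Continuous fun q : Conf d m =>
      (∑ j ∈ C.part i, m j • q.1 j : EuclideanSpace ℝ (Fin d)) :=
    continuous_finsetSum _ fun j _ => (continuous_position j).const_smul (m j)
  exact hs.const_smul (∑ j ∈ C.part i, m j)⁻¹

theorem continuous_projI (hm : ∀ i, 0 < m i) (C : ClusterPartition n) :
    Continuous (projI (d := d) hm C) :=
  continuous_id.sub (continuous_projE hm C)

theorem continuous_inertia : Continuous (inertia (d := d) (m := m)) := by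
  change Continuous fun q : Conf d m => ∑ i, m i * inner ℝ (q.1 i) (q.1 i)
  refine continuous_finsetSum _ fun i _ => ?_
  exact continuous_const.mul ((continuous_position i).inner (continuous_position i))

theorem exists_mem_external_of_mem_collisionSet {q : Conf d m} (hq : q ∈ collisionSet d m) :
    ∃ C : CollisionPartition n, q ∈ external d m C.1 := by
  obtain ⟨i, j, hij, h⟩ := hq
  obtain ⟨C, hC⟩ := exists_collisionPartition (r := Setoid.ker q.1) hij h
  exact ⟨C, fun i j h => (hC i j).1 h⟩

theorem mem_collisionSet_of_mem_external {q : Conf d m} {C : CollisionPartition n}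
    (hq : q ∈ external d m C.1) : q ∈ collisionSet d m := by
  obtain ⟨i, j, hij, h⟩ := ne_bot_iff.1 C.2
  exact ⟨i, j, hij, hq i j h⟩

theorem smul_mem_collisionSet_iff {t : ℝ} (ht : t ≠ 0) {q : Conf d m} :
    t • q ∈ collisionSet d m ↔ q ∈ collisionSet d m := by
  simp [collisionSet, smul_right_inj ht]

theorem compactSpace_internalSphere (hm : ∀ i, 0 < m i) (C : ClusterPartition n) :
    CompactSpace (InternalSphere d m C) := by
  refine isCompact_iff_compactSpace.1 (Metric.isCompact_of_isClosed_isBounded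
    (isClosed_singleton.preimage (continuous_inertia.comp continuous_subtype_val)) ?_)
  change Bornology.IsBounded {x : internal d m C | inertia x.1 = 1}
  refine (isBounded_iff_forall_norm_le (E := internal d m C)).2 ⟨∑ i, (m i)⁻¹ + 1, fun x hx => ?_⟩
  have hR : ∀ i, (m i)⁻¹ ≤ ∑ i, (m i)⁻¹ := fun i =>
    Finset.single_le_sum (f := fun i => (m i)⁻¹) (fun i _ => (inv_pos.2 (hm i)).le)
      (Finset.mem_univ i)
  have hR0 : 0 ≤ ∑ i, (m i)⁻¹ := Finset.sum_nonneg fun i _ => (inv_pos.2 (hm i)).le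
  change ‖x.1.1‖ ≤ _
  refine (pi_norm_le_iff_of_nonneg (by linarith)).2 fun i => ?_
  have h1 : m i * ‖x.1.1 i‖ ^ 2 ≤ 1 := by
    have h2 : inertia x.1 = 1 := hx
    rw [← h2, inertia, massInner, ← real_inner_self_eq_norm_sq]
    exact Finset.single_le_sum (f := fun i => m i * inner ℝ (x.1.1 i) (x.1.1 i))
      (fun i _ => mul_nonneg (hm i).le real_inner_self_nonneg) (Finset.mem_univ i)
  have h3 : ‖x.1.1 i‖ ^ 2 ≤ (m i)⁻¹ := by
    rw [← one_div, le_div_iff₀ (hm i)]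
    linarith
  nlinarith [hR i, sq_nonneg (‖x.1.1 i‖ - 1)]

end Mass

/-! ### Radial homeomorphisms -/

section Radial

variable {V : Type*} [AddCommGroup V] [Module ℝ V] [TopologicalSpace V] [ContinuousSMul ℝ V]

/-- Two positive functions on a cone that are homogeneous of degree one have homeomorphic unit
level sets, by rescaling along the rays. -/
theorem exists_radial_homeomorph {K S T : Set V} {μ ν : V → ℝ} (hμ : Continuous μ)
    (hν : Continuous ν) (hK : ∀ x ∈ K, ∀ t : ℝ, 0 < t → t • x ∈ K)
    (hμK : ∀ x ∈ K, 0 < μ x) (hνK : ∀ x ∈ K, 0 < ν x)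
    (hμs : ∀ x, ∀ t : ℝ, 0 < t → μ (t • x) = t * μ x)
    (hνs : ∀ x, ∀ t : ℝ, 0 < t → ν (t • x) = t * ν x)
    (hS : ∀ x, x ∈ S ↔ x ∈ K ∧ μ x = 1) (hT : ∀ x, x ∈ T ↔ x ∈ K ∧ ν x = 1) :
    ∃ H : S ≃ₜ T, ∀ s, (H s).1 = (ν s.1)⁻¹ • s.1 := by
  have key : ∀ {S T : Set V} {μ ν : V → ℝ}, Continuous ν → (∀ x ∈ K, 0 < ν x) →
      (∀ x, ∀ t : ℝ, 0 < t → ν (t • x) = t * ν x) → (∀ x, x ∈ S ↔ x ∈ K ∧ μ x = 1) →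
      (∀ x, x ∈ T ↔ x ∈ K ∧ ν x = 1) → ∃ f : S → T, Continuous f ∧
        ∀ s, (f s).1 = (ν s.1)⁻¹ • s.1 := by
    intro S T μ ν hν hνK hνs hS hT
    have hpos : ∀ s : S, 0 < ν s.1 := fun s => hνK _ ((hS _).1 s.2).1
    refine ⟨fun s => ⟨(ν s.1)⁻¹ • s.1, (hT _).2
      ⟨hK _ ((hS _).1 s.2).1 _ (inv_pos.2 (hpos s)), ?_⟩⟩, ?_, fun s => rfl⟩
    · rw [hνs _ _ (inv_pos.2 (hpos s)), inv_mul_cancel₀ (hpos s).ne']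
    · exact (((hν.comp continuous_subtype_val).inv₀ fun s => (hpos s).ne').smul
        continuous_subtype_val).subtype_mk _
  obtain ⟨f, hf, hf'⟩ := key hν hνK hνs hS hT
  obtain ⟨g, hg, hg'⟩ := key hμ hμK hμs hT hS
  have inv : ∀ {μ ν : V → ℝ} {x : V}, μ x = 1 → 0 < ν x →
      (∀ x, ∀ t : ℝ, 0 < t → μ (t • x) = t * μ x) →
      (μ ((ν x)⁻¹ • x))⁻¹ • (ν x)⁻¹ • x = x := by
    intro μ ν x hx hν hμs
    rw [hμs _ _ (inv_pos.2 hν), hx, mul_one, inv_inv, smul_smul, mul_inv_cancel₀ hν.ne',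
      one_smul]
  refine ⟨⟨⟨f, g, fun s => Subtype.ext ?_, fun s => Subtype.ext ?_⟩, hf, hg⟩, hf'⟩
  · have hs := (hS _).1 s.2
    rw [hg', hf', inv hs.2 (hνK _ hs.1) hμs]
  · have hs := (hT _).1 s.2
    rw [hf', hg', inv hs.2 (hμK _ hs.1) hνs]

/-- The superlevel set of a continuous function that is homogeneous of degree one is bounded by
the level set. -/
theorem frontier_one_le {ν : V → ℝ} (hν : Continuous ν)
    (hνs : ∀ x, ∀ t : ℝ, 0 < t → ν (t • x) = t * ν x) :
    frontier {x | 1 ≤ ν x} = {x | ν x = 1} := by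
  refine subset_antisymm (fun x hx => (frontier_le_subset_eq continuous_const hν hx).symm)
    fun x hx => ?_
  have hx : ν x = 1 := hx
  refine ⟨subset_closure hx.ge, fun hint => ?_⟩
  have hev : ∀ᶠ t : ℝ in 𝓝 1, 1 ≤ ν (t • x) := by
    have hc : ContinuousAt (fun t : ℝ => t • x) 1 := by fun_prop
    refine hc.eventually (p := fun y => 1 ≤ ν y) ?_
    simp only [one_smul]
    exact mem_interior_iff_mem_nhds.1 hint
  have hev' : ∀ᶠ t : ℝ in 𝓝[<] 1, 1 ≤ ν (t • x) := hev.filter_mono nhdsWithin_le_nhds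
  obtain ⟨t, ht1, ht⟩ := (hev'.and (Ioo_mem_nhdsLT (zero_lt_one (α := ℝ)))).exists
  rw [hνs x t ht.1, hx] at ht1
  linarith [ht.2]

end Radial

/-! ### The boundary of the free atom -/

section FreeAtom

variable {n d : ℕ} {m : Fin n → ℝ}

theorem nonempty_collisionPartition (hn : 2 ≤ n) : Nonempty (CollisionPartition n) := by
  obtain ⟨C, -⟩ := exists_collisionPartition (r := (⊤ : Setoid (Fin n)))
    (i := ⟨0, by omega⟩) (j := ⟨1, by omega⟩) (by simp) trivial
  exact ⟨C⟩

/-- The function, homogeneous of degree one, whose superlevel set is the free atom. -/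
noncomputable def freeGauge (hn : 2 ≤ n) (hm : ∀ i, 0 < m i) (δ : ℝ) (q : Conf d m) : ℝ :=
  haveI := nonempty_collisionPartition hn
  Finset.univ.inf' Finset.univ_nonempty fun C : CollisionPartition n =>
    √(inertia (projI hm C.1 q) / (δ ^ C.1.parts.card - δ ^ n))

theorem sub_pow_pos {δ : ℝ} (hδ : δ ∈ Set.Ioo (0 : ℝ) 1) (C : CollisionPartition n) :
    0 < δ ^ C.1.parts.card - δ ^ n :=
  sub_pos.2 (pow_lt_pow_right_of_lt_one₀ hδ.1 hδ.2 (card_parts_lt C))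

theorem le_freeGauge_iff (hn : 2 ≤ n) (hm : ∀ i, 0 < m i) {δ a : ℝ} {q : Conf d m} :
    a ≤ freeGauge hn hm δ q ↔ ∀ C : CollisionPartition n,
      a ≤ √(inertia (projI hm C.1 q) / (δ ^ C.1.parts.card - δ ^ n)) := by
  simp [freeGauge, Finset.le_inf'_iff]

theorem continuous_freeGauge (hn : 2 ≤ n) (hm : ∀ i, 0 < m i) (δ : ℝ) :
    Continuous (freeGauge (d := d) hn hm δ) := by
  refine Continuous.finset_inf'_apply _ fun C _ => ?_
  exact ((continuous_inertia.comp (continuous_projI hm C.1)).div_const _).sqrt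

theorem freeGauge_smul (hn : 2 ≤ n) (hm : ∀ i, 0 < m i) (δ : ℝ) (q : Conf d m) (t : ℝ)
    (ht : 0 < t) : freeGauge hn hm δ (t • q) = t * freeGauge hn hm δ q := by
  have h : ∀ C : CollisionPartition n,
      √(inertia (projI hm C.1 (t • q)) / (δ ^ C.1.parts.card - δ ^ n))
        = t * √(inertia (projI hm C.1 q) / (δ ^ C.1.parts.card - δ ^ n)) := by
    intro C
    rw [projI_smul, inertia_smul, mul_div_assoc, Real.sqrt_mul (sq_nonneg t),
      Real.sqrt_sq ht.le]
  refine eq_of_forall_le_iff fun a => ?_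
  rw [le_freeGauge_iff]
  simp_rw [h]
  rw [mul_comm t, ← div_le_iff₀ ht, le_freeGauge_iff]
  simp_rw [mul_comm t, ← div_le_iff₀ ht]

theorem freeGauge_pos (hn : 2 ≤ n) (hm : ∀ i, 0 < m i) {δ : ℝ} (hδ : δ ∈ Set.Ioo (0 : ℝ) 1)
    {q : Conf d m} (hq : q ∉ collisionSet d m) : 0 < freeGauge hn hm δ q := by
  rw [freeGauge, Finset.lt_inf'_iff]
  refine fun C _ => Real.sqrt_pos.2 (div_pos ?_ (sub_pow_pos hδ C))
  exact inertia_pos hm (projI_ne_zero hm C.2 hq)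

theorem notMem_collisionSet_of_freeGauge_pos (hn : 2 ≤ n) (hm : ∀ i, 0 < m i) {δ : ℝ}
    {q : Conf d m} (h : 0 < freeGauge hn hm δ q) : q ∉ collisionSet d m := by
  intro hq
  obtain ⟨C, hC⟩ := exists_mem_external_of_mem_collisionSet hq
  have h1 := (le_freeGauge_iff hn hm).1 (le_refl (freeGauge hn hm δ q)) C
  rw [projI_eq_zero hm hC, show inertia (0 : Conf d m) = 0 by simp [inertia, massInner],
    zero_div, Real.sqrt_zero] at h1
  linarith

theorem grafAtom_bot (hn : 2 ≤ n) (hm : ∀ i, 0 < m i) {δ : ℝ} (hδ : δ ∈ Set.Ioo (0 : ℝ) 1) :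
    grafAtom d hm δ ⊥ = {q | 1 ≤ freeGauge hn hm δ q} := by
  ext q
  have hbot : projE hm ⊥ q = q := by
    refine projE_eq_of_eq_add hm (fun i j hij => ?_) (Submodule.zero_mem _) (add_zero q)
    rw [part_bot, part_bot, Finset.singleton_inj] at hij
    rw [hij]
  have hcard : (⊥ : ClusterPartition n).parts.card = n := by
    rw [Finpartition.card_bot, Finset.card_univ, Fintype.card_fin]
  have hle : inertia (projE hm ⊥ q) + δ ^ (⊥ : ClusterPartition n).parts.card
      ≤ grafMax hm δ q :=
    Finset.le_sup' (fun C : ClusterPartition n =>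
      inertia (projE hm C q) + δ ^ C.parts.card) (Finset.mem_univ ⊥)
  rw [grafAtom, Set.mem_ofPred_eq, Set.mem_ofPred_eq]
  have hsup : grafMax hm δ q ≤ inertia (projE hm ⊥ q) + δ ^ (⊥ : ClusterPartition n).parts.card ↔
      ∀ C : ClusterPartition n, inertia (projE hm C q) + δ ^ C.parts.card
        ≤ inertia q + δ ^ n := by
    rw [hbot, hcard]
    exact (Finset.sup'_le_iff _ _).trans ⟨fun h C => h C (Finset.mem_univ C), fun h C _ => h C⟩
  rw [le_freeGauge_iff, le_antisymm_iff, and_iff_right hle, hsup]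
  have key : ∀ C : CollisionPartition n,
      (1 ≤ √(inertia (projI hm C.1 q) / (δ ^ C.1.parts.card - δ ^ n))
        ↔ inertia (projE hm C.1 q) + δ ^ C.1.parts.card ≤ inertia q + δ ^ n) := by
    intro C
    rw [Real.one_le_sqrt, le_div_iff₀ (sub_pow_pos hδ C), inertia_eq_add hm C.1 q]
    constructor <;> intro h <;> linarith
  constructor
  · exact fun h C => (key C).2 (h C.1)
  · intro h C
    by_cases hC : C = ⊥
    · subst hC
      rw [hbot, hcard]
    · exact (key ⟨C, hC⟩).1 (h ⟨C, hC⟩)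

theorem mem_freeBoundary_iff (hn : 2 ≤ n) (hm : ∀ i, 0 < m i) {δ : ℝ}
    (hδ : δ ∈ Set.Ioo (0 : ℝ) 1) (q : Conf d m) :
    q ∈ freeBoundary d hm δ ↔ q ∈ (collisionSet d m)ᶜ ∧ freeGauge hn hm δ q = 1 := by
  have hfr : frontier {q : Conf d m | 1 ≤ freeGauge hn hm δ q}
      = {q | freeGauge hn hm δ q = 1} := by
    refine frontier_one_le (continuous_freeGauge hn hm δ) ?_
    intro x t ht
    exact freeGauge_smul hn hm δ x t ht
  rw [freeBoundary, grafAtom_bot hn hm hδ, hfr]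
  refine ⟨fun h => ⟨?_, h⟩, fun h => h.2⟩
  refine notMem_collisionSet_of_freeGauge_pos hn hm (δ := δ) ?_
  rw [show freeGauge hn hm δ q = 1 from h]
  exact one_pos

theorem mem_puncturedSphere_iff (q : Conf d m) :
    q ∈ puncturedSphere d m ↔ q ∈ (collisionSet d m)ᶜ ∧ √(inertia q) = 1 := by
  rw [Real.sqrt_eq_one]
  exact and_comm

theorem smul_mem_compl_collisionSet {q : Conf d m} (hq : q ∈ (collisionSet d m)ᶜ) (t : ℝ)
    (ht : 0 < t) : t • q ∈ (collisionSet d m)ᶜ :=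
  fun h => hq ((smul_mem_collisionSet_iff ht.ne').1 h)

theorem sqrt_inertia_smul (q : Conf d m) (t : ℝ) (ht : 0 < t) :
    √(inertia (t • q)) = t * √(inertia q) := by
  rw [inertia_smul, Real.sqrt_mul (sq_nonneg t), Real.sqrt_sq ht.le]

theorem ne_zero_of_notMem_collisionSet (hn : 2 ≤ n) {q : Conf d m}
    (hq : q ∉ collisionSet d m) : q ≠ 0 := by
  rintro rfl
  exact hq ⟨⟨0, by omega⟩, ⟨1, by omega⟩, by simp, rfl⟩

theorem sqrt_inertia_pos (hn : 2 ≤ n) (hm : ∀ i, 0 < m i) {q : Conf d m}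
    (hq : q ∈ (collisionSet d m)ᶜ) : 0 < √(inertia q) :=
  Real.sqrt_pos.2 (inertia_pos hm (ne_zero_of_notMem_collisionSet hn hq))

theorem exists_homeomorph_freeBoundary (hn : 2 ≤ n) (hm : ∀ i, 0 < m i) {δ : ℝ}
    (hδ : δ ∈ Set.Ioo (0 : ℝ) 1) :
    ∃ H : puncturedSphere d m ≃ₜ freeBoundary d hm δ, ∀ s : puncturedSphere d m,
      {q : Conf d m | ∃ t : ℝ, 0 < t ∧ q = t • s.1} ∩ freeBoundary d hm δ = {(H s).1} := by
  obtain ⟨H, hH⟩ : ∃ H : puncturedSphere d m ≃ₜ freeBoundary d hm δ,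
      ∀ s, (H s).1 = (freeGauge hn hm δ s.1)⁻¹ • s.1 := by
    refine exists_radial_homeomorph (continuous_inertia.sqrt)
      (continuous_freeGauge hn hm δ) ?_ ?_ ?_ ?_ ?_ mem_puncturedSphere_iff
      (mem_freeBoundary_iff hn hm hδ)
    · intro x hx t ht
      exact smul_mem_compl_collisionSet hx t ht
    · exact fun x hx => sqrt_inertia_pos hn hm hx
    · exact fun x hx => freeGauge_pos hn hm hδ hx
    · intro x t ht
      exact sqrt_inertia_smul x t ht
    · intro x t ht
      exact freeGauge_smul hn hm δ x t ht
  refine ⟨H, fun s => Set.eq_singleton_iff_unique_mem.2 ⟨⟨⟨(freeGauge hn hm δ s.1)⁻¹, ?_, hH s⟩,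
    (H s).2⟩, ?_⟩⟩
  · exact inv_pos.2 (freeGauge_pos hn hm hδ s.2.2)
  · rintro q ⟨⟨t, ht, rfl⟩, hq⟩
    have h1 := ((mem_freeBoundary_iff hn hm hδ _).1 hq).2
    rw [freeGauge_smul _ _ _ _ _ ht] at h1
    rw [hH, eq_inv_of_mul_eq_one_left h1]

end FreeAtom

/-! ### The graph blow-up as a spherical blow-up -/

section Centre

open CentredConf

variable {n d : ℕ} {m : Fin n → ℝ}

/-- The translation of a configuration with centre of mass zero to the one whose centre of mass
for equal masses is zero. -/
noncomputable def centreEquiv (hn : 2 ≤ n) (hm : ∀ i, 0 < m i) :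
    Conf d m ≃ₗ[ℝ] CentredConf n d where
  toFun q := CentredConf.mk (fun i => q.1 i - (n : ℝ)⁻¹ • ∑ j, q.1 j) <| by
    have h : (n : ℝ) ≠ 0 := Nat.cast_ne_zero.2 (by omega)
    rw [Finset.sum_sub_distrib, Finset.sum_const, Finset.card_univ, Fintype.card_fin,
      ← Nat.cast_smul_eq_nsmul ℝ, smul_inv_smul₀ h, sub_self]
  invFun y := ⟨fun i => coord i y - (∑ j, m j)⁻¹ • ∑ j, m j • coord j y, by
    have h : ∑ j, m j ≠ 0 :=
      (Finset.sum_pos (fun j _ => hm j) ⟨⟨0, by omega⟩, Finset.mem_univ _⟩).ne'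
    change ∑ i, m i • (coord i y - (∑ j, m j)⁻¹ • ∑ j, m j • coord j y) = 0
    simp_rw [smul_sub]
    rw [Finset.sum_sub_distrib, ← Finset.sum_smul, smul_inv_smul₀ h, sub_self]⟩
  map_add' p q := by
    refine CentredConf.ext fun i => ?_
    change (p.1 i + q.1 i) - (n : ℝ)⁻¹ • ∑ j, (p.1 j + q.1 j)
      = (p.1 i - (n : ℝ)⁻¹ • ∑ j, p.1 j) + (q.1 i - (n : ℝ)⁻¹ • ∑ j, q.1 j)
    rw [Finset.sum_add_distrib, smul_add]
    abel
  map_smul' c q := by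
    refine CentredConf.ext fun i => ?_
    change c • q.1 i - (n : ℝ)⁻¹ • ∑ j, c • q.1 j = c • (q.1 i - (n : ℝ)⁻¹ • ∑ j, q.1 j)
    rw [← Finset.smul_sum, smul_sub, smul_comm c]
  left_inv q := by
    have h : ∑ j, m j ≠ 0 :=
      (Finset.sum_pos (fun j _ => hm j) ⟨⟨0, by omega⟩, Finset.mem_univ _⟩).ne'
    refine Subtype.ext (funext fun i => ?_)
    have hq : ∑ j, m j • q.1 j = 0 := q.2
    change (q.1 i - (n : ℝ)⁻¹ • ∑ j, q.1 j)
      - (∑ j, m j)⁻¹ • ∑ j, m j • (q.1 j - (n : ℝ)⁻¹ • ∑ j, q.1 j) = q.1 i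
    simp_rw [smul_sub]
    rw [Finset.sum_sub_distrib, ← Finset.sum_smul, hq, zero_sub, smul_neg, inv_smul_smul₀ h]
    abel
  right_inv y := by
    have h : (n : ℝ) ≠ 0 := Nat.cast_ne_zero.2 (by omega)
    refine CentredConf.ext fun i => ?_
    change (coord i y - (∑ j, m j)⁻¹ • ∑ j, m j • coord j y)
      - (n : ℝ)⁻¹ • ∑ k, (coord k y - (∑ j, m j)⁻¹ • ∑ j, m j • coord j y) = coord i y
    rw [Finset.sum_sub_distrib, sum_coord, Finset.sum_const, Finset.card_univ, Fintype.card_fin,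
      ← Nat.cast_smul_eq_nsmul ℝ, zero_sub, smul_neg, inv_smul_smul₀ h]
    abel

theorem coord_centreEquiv (hn : 2 ≤ n) (hm : ∀ i, 0 < m i) (q : Conf d m) (i : Fin n) :
    coord i (centreEquiv hn hm q) = q.1 i - (n : ℝ)⁻¹ • ∑ j, q.1 j := rfl

theorem centreEquiv_mem_coincide_iff (hn : 2 ≤ n) (hm : ∀ i, 0 < m i) (C : CollisionPartition n)
    (q : Conf d m) : centreEquiv hn hm q ∈ coincide d C ↔ q ∈ external d m C.1 := by
  refine forall₃_congr fun i j _ => ?_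
  rw [coord_centreEquiv, coord_centreEquiv, sub_left_inj]

theorem continuous_centreEquiv (hn : 2 ≤ n) (hm : ∀ i, 0 < m i) :
    Continuous (centreEquiv (d := d) hn hm) :=
  (centreEquiv (d := d) hn hm).toLinearMap.continuous_of_finiteDimensional

theorem continuous_centreEquiv_symm (hn : 2 ≤ n) (hm : ∀ i, 0 < m i) :
    Continuous (centreEquiv (d := d) hn hm).symm :=
  (centreEquiv (d := d) hn hm).symm.toLinearMap.continuous_of_finiteDimensional

theorem forall_centreEquiv_notMem_iff (hn : 2 ≤ n) (hm : ∀ i, 0 < m i) (q : Conf d m) :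
    (∀ C, centreEquiv hn hm q ∉ coincide d C) ↔ q ∉ collisionSet d m := by
  simp_rw [centreEquiv_mem_coincide_iff]
  constructor
  · intro h hq
    obtain ⟨C, hC⟩ := exists_mem_external_of_mem_collisionSet hq
    exact h C hC
  · exact fun h C hC => h (mem_collisionSet_of_mem_external hC)

end Centre

section GraphBlowUp

variable {n d : ℕ} {m : Fin n → ℝ}

/-- The configuration with the polar coordinates `b C`. -/
def basePoint (C : CollisionPartition n) (b : ∀ C : CollisionPartition n, BlowUp d m C.1) :
    Conf d m :=
  (b C).1.1 + (b C).2.1.1 • (b C).2.2.1.1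

variable {C : CollisionPartition n} {b : ∀ C : CollisionPartition n, BlowUp d m C.1}

theorem continuous_normal (C : CollisionPartition n) :
    Continuous fun b : ∀ C : CollisionPartition n, BlowUp d m C.1 => (b C).2.2.1.1 :=
  continuous_subtype_val.comp (continuous_subtype_val.comp
    (continuous_snd.comp (continuous_snd.comp (continuous_apply C))))

theorem continuous_basePoint (C : CollisionPartition n) :
    Continuous (basePoint (d := d) (m := m) C) := by
  have h1 : Continuous fun b : ∀ C : CollisionPartition n, BlowUp d m C.1 => (b C).1.1 :=
    continuous_subtype_val.comp (continuous_fst.comp (continuous_apply C))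
  have h2 : Continuous fun b : ∀ C : CollisionPartition n, BlowUp d m C.1 => (b C).2.1.1 :=
    continuous_subtype_val.comp (continuous_fst.comp (continuous_snd.comp (continuous_apply C)))
  exact h1.add (h2.smul (continuous_normal C))

theorem projE_basePoint (hm : ∀ i, 0 < m i) : projE hm C.1 (basePoint C b) = (b C).1.1 :=
  projE_eq_of_eq_add hm (b C).1.2 (Submodule.smul_mem _ _ (b C).2.2.1.2) rfl

theorem projI_basePoint (hm : ∀ i, 0 < m i) :
    projI hm C.1 (basePoint C b) = (b C).2.1.1 • (b C).2.2.1.1 := by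
  rw [projI, projE_basePoint, basePoint, add_sub_cancel_left]

theorem sqrt_inertia_basePoint (hm : ∀ i, 0 < m i) :
    √(inertia (projI hm C.1 (basePoint C b))) = (b C).2.1.1 := by
  rw [projI_basePoint, inertia_smul, (b C).2.2.2, mul_one, Real.sqrt_sq (b C).2.1.2]

theorem basePoint_diagonalMap (hm : ∀ i, 0 < m i) (C : CollisionPartition n)
    (q : {q : Conf d m // q ∉ collisionSet d m}) : basePoint C (diagonalMap d hm q) = q.1 := by
  have h := inertia_pos hm (projI_ne_zero hm C.2 q.2)
  change projE hm C.1 q.1 + √(inertia (projI hm C.1 q.1)) •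
    (√(inertia (projI hm C.1 q.1)))⁻¹ • projI hm C.1 q.1 = q.1
  rw [smul_inv_smul₀ (Real.sqrt_pos.2 h).ne', projE_add_projI]

theorem basePoint_eq (hm : ∀ i, 0 < m i) (hb : b ∈ graphBlowUp d hm)
    (C D : CollisionPartition n) : basePoint C b = basePoint D b := by
  have hcl : IsClosed {b : ∀ C : CollisionPartition n, BlowUp d m C.1 |
      basePoint C b = basePoint D b} :=
    isClosed_eq (continuous_basePoint C) (continuous_basePoint D)
  refine closure_minimal ?_ hcl hb
  rintro _ ⟨q, rfl⟩
  exact (basePoint_diagonalMap hm C q).trans (basePoint_diagonalMap hm D q).symm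

theorem eq_diagonalMap (hm : ∀ i, 0 < m i) (hb : b ∈ graphBlowUp d hm) {D : CollisionPartition n}
    (h : basePoint D b ∉ collisionSet d m) : b = diagonalMap d hm ⟨basePoint D b, h⟩ := by
  funext C
  have hC := basePoint_eq hm hb D C
  refine Prod.ext (Subtype.ext ?_) (Prod.ext (Subtype.ext ?_) (Subtype.ext (Subtype.ext ?_)))
  · change _ = projE hm C.1 (basePoint D b)
    rw [hC, projE_basePoint]
  · change _ = √(inertia (projI hm C.1 (basePoint D b)))
    rw [hC, sqrt_inertia_basePoint]
  · change _ = (√(inertia (projI hm C.1 (basePoint D b))))⁻¹ • projI hm C.1 (basePoint D b)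
    have h0 := projI_ne_zero hm C.2 h
    rw [hC, projI_basePoint] at h0
    rw [hC, sqrt_inertia_basePoint, projI_basePoint, inv_smul_smul₀ (left_ne_zero_of_smul h0)]

theorem mem_blowUpBoundary_iff (hm : ∀ i, 0 < m i) (D : CollisionPartition n) :
    b ∈ blowUpBoundary d hm ↔ b ∈ graphBlowUp d hm ∧ basePoint D b ∈ collisionSet d m := by
  refine and_congr_right fun hb => ⟨fun h => ?_, ?_⟩
  · by_contra hcol
    exact h ⟨_, (eq_diagonalMap hm hb hcol).symm⟩
  · rintro h ⟨q, rfl⟩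
    rw [basePoint_diagonalMap] at h
    exact q.2 h

theorem notMem_external_of_inertia_eq_one (hm : ∀ i, 0 < m i) (C : CollisionPartition n)
    (x : InternalSphere d m C.1) : x.1.1 ∉ external d m C.1 := by
  intro h
  have h0 := eq_zero_of_mem_external_of_mem_internal hm h x.1.2
  have h1 := x.2
  rw [h0] at h1
  simp [inertia, massInner] at h1

theorem isCompact_setOf_norm_basePoint_le (hn : 2 ≤ n) (hm : ∀ i, 0 < m i)
    (D : CollisionPartition n) (R : ℝ) :
    IsCompact {b | b ∈ graphBlowUp d hm ∧ ‖centreEquiv hn hm (basePoint D b)‖ ≤ R} := by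
  set K : Set (Conf d m) := (centreEquiv hn hm).symm '' Metric.closedBall 0 R with hK
  have hKc : IsCompact K :=
    (isCompact_closedBall (0 : CentredConf n d) R).image (continuous_centreEquiv_symm hn hm)
  have hE : ∀ C : CollisionPartition n, IsCompact ((fun q : Conf d m =>
      (⟨projE hm C.1 q, projE_mem hm C.1 q⟩ : external d m C.1)) '' K) := fun C =>
    hKc.image ((continuous_projE hm C.1).subtype_mk _)
  have hr : ∀ C : CollisionPartition n, IsCompact ((fun q : Conf d m =>
      (⟨√(inertia (projI hm C.1 q)), Real.sqrt_nonneg _⟩ : Set.Ici (0 : ℝ))) '' K) := fun C =>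
    hKc.image ((continuous_inertia.comp (continuous_projI hm C.1)).sqrt.subtype_mk _)
  have := fun C : CollisionPartition n => compactSpace_internalSphere (d := d) hm C.1
  refine (isCompact_univ_pi fun C =>
    (hE C).prod ((hr C).prod (isCompact_univ (X := InternalSphere d m C.1)))).of_isClosed_subset
    ?_ ?_
  · exact isClosed_closure.inter (isClosed_le
      ((continuous_centreEquiv hn hm).comp (continuous_basePoint D)).norm continuous_const)
  · rintro b ⟨hb, hbR⟩ C -
    have hmem : basePoint C b ∈ K := by
      rw [basePoint_eq hm hb C D]
      exact ⟨_, mem_closedBall_zero_iff.2 hbR, (centreEquiv hn hm).symm_apply_apply _⟩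
    exact ⟨⟨_, hmem, Subtype.ext (projE_basePoint hm)⟩,
      ⟨_, hmem, Subtype.ext (sqrt_inertia_basePoint hm)⟩, Set.mem_univ _⟩

/-- The component of the normal direction at `C` that is orthogonal to the collision subspace for
equal masses. -/
noncomputable def normalComponent (hn : 2 ≤ n) (hm : ∀ i, 0 < m i) (C : CollisionPartition n)
    (b : graphBlowUp d hm) : CentredConf n d :=
  perp (coincide d) C (centreEquiv hn hm (b.1 C).2.2.1.1)

theorem norm_normalComponent_pos (hn : 2 ≤ n) (hm : ∀ i, 0 < m i) (C : CollisionPartition n)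
    (b : graphBlowUp d hm) : 0 < ‖normalComponent hn hm C b‖ := by
  refine norm_pos_iff.2 fun h => notMem_external_of_inertia_eq_one hm C (b.1 C).2.2 ?_
  rw [← centreEquiv_mem_coincide_iff hn hm]
  exact perp_eq_zero_iff.1 h

/-- The graph blow-up for arbitrary masses is a spherical blow-up of the equal mass configuration
space: its normal directions are recovered from the mass dependent ones by projection. -/
theorem isSphericalBlowUp_graphBlowUp (hn : 2 ≤ n) (hm : ∀ i, 0 < m i)
    (D : CollisionPartition n) :
    IsSphericalBlowUp (coincide (n := n) d)
      (fun b : graphBlowUp d hm => centreEquiv hn hm (basePoint D b.1))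
      (fun C b => ‖normalComponent hn hm C b‖⁻¹ • normalComponent hn hm C b) where
  continuous_q := (continuous_centreEquiv hn hm).comp
    ((continuous_basePoint D).comp continuous_subtype_val)
  continuous_U C := by
    have h : Continuous (normalComponent (d := d) hn hm C) :=
      (ContinuousLinearMap.continuous _).comp ((continuous_centreEquiv hn hm).comp
        ((continuous_normal C).comp continuous_subtype_val))
    exact (h.norm.inv₀ fun b => (norm_normalComponent_pos hn hm C b).ne').smul h
  norm_U C b := by
    rw [norm_smul, norm_inv, norm_norm, inv_mul_cancel₀ (norm_normalComponent_pos hn hm C b).ne']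
  U_mem C b := Submodule.smul_mem _ _ (perp_mem _ _ _)
  perp_q C b := by
    have hpos := norm_normalComponent_pos hn hm C b
    have hr : 0 ≤ (b.1 C).2.1.1 := (b.1 C).2.1.2
    have h1 : perp (coincide d) C (centreEquiv hn hm (basePoint D b.1))
        = (b.1 C).2.1.1 • normalComponent hn hm C b := by
      have hE : perp (coincide d) C (centreEquiv hn hm (b.1 C).1.1) = 0 :=
        perp_eq_zero_iff.2 ((centreEquiv_mem_coincide_iff hn hm C _).2 (b.1 C).1.2)
      rw [basePoint_eq hm b.2 D C, basePoint, map_add, map_smul, perp, map_add, map_smul]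
      rw [perp] at hE
      rw [hE, zero_add]
      rfl
    rw [h1, norm_smul, Real.norm_of_nonneg hr, smul_smul, mul_assoc, mul_inv_cancel₀ hpos.ne',
      mul_one]
  dense_regular := by
    rw [Subtype.dense_iff]
    intro b hb
    refine closure_mono ?_ hb
    rintro _ ⟨q, rfl⟩
    refine ⟨⟨_, subset_closure ⟨q, rfl⟩⟩, ?_, rfl⟩
    refine (forall_centreEquiv_notMem_iff hn hm _).2 ?_
    rw [basePoint_diagonalMap]
    exact q.2
  exists_regular x hx := by
    obtain ⟨q, rfl⟩ := (centreEquiv (d := d) hn hm).surjective x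
    have hq := (forall_centreEquiv_notMem_iff hn hm q).1 hx
    exact ⟨⟨_, subset_closure ⟨⟨q, hq⟩, rfl⟩⟩,
      congrArg (centreEquiv hn hm) (basePoint_diagonalMap hm D ⟨q, hq⟩)⟩
  ext b b' hq hU := by
    have hbase : ∀ C, basePoint C b.1 = basePoint C b'.1 := fun C => by
      rw [basePoint_eq hm b.2 C D, basePoint_eq hm b'.2 C D]
      exact (centreEquiv hn hm).injective hq
    refine Subtype.ext (funext fun C => ?_)
    refine Prod.ext (Subtype.ext ?_) (Prod.ext (Subtype.ext ?_) (Subtype.ext (Subtype.ext ?_)))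
    · rw [← projE_basePoint hm, hbase C, projE_basePoint hm]
    · rw [← sqrt_inertia_basePoint hm, hbase C, sqrt_inertia_basePoint hm]
    · -- The normal directions are positive multiples of each other modulo the collision subspace.
      have hpos := norm_normalComponent_pos hn hm C b
      have hpos' := norm_normalComponent_pos hn hm C b'
      set s := ‖normalComponent hn hm C b‖⁻¹ with hs
      set s' := ‖normalComponent hn hm C b'‖⁻¹ with hs'
      set x := (b.1 C).2.2 with hx
      set x' := (b'.1 C).2.2 with hx'
      have hs0 : 0 < s := inv_pos.2 hpos
      have hs0' : 0 < s' := inv_pos.2 hpos'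
      have h1 : s • x.1.1 - s' • x'.1.1 ∈ external d m C.1 := by
        rw [← centreEquiv_mem_coincide_iff hn hm, ← perp_eq_zero_iff, map_sub, map_smul, map_smul,
          perp, map_sub, map_smul, map_smul, sub_eq_zero]
        exact hU C
      have h2 : s • x.1.1 = s' • x'.1.1 :=
        sub_eq_zero.1 (eq_zero_of_mem_external_of_mem_internal hm h1
          (Submodule.sub_mem _ (Submodule.smul_mem _ _ x.1.2) (Submodule.smul_mem _ _ x'.1.2)))
      have h3 : s = s' := by
        have h4 := congrArg inertia h2
        rw [inertia_smul, inertia_smul, x.2, x'.2, mul_one, mul_one] at h4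
        exact (pow_left_inj₀ hs0.le hs0'.le two_ne_zero).1 h4
      rw [← h3] at h2
      exact smul_right_injective _ hs0.ne' h2
  isCompact_preimage R := by
    rw [Subtype.isCompact_iff]
    convert isCompact_setOf_norm_basePoint_le hn hm D R using 1
    ext b
    constructor
    · rintro ⟨b, hb, rfl⟩
      exact ⟨b.2, hb⟩
    · rintro ⟨hb, hR⟩
      exact ⟨⟨b, hb⟩, hR, rfl⟩

theorem nonempty_homeomorph_puncturedSphere (hn : 2 ≤ n) (hm : ∀ i, 0 < m i) :
    Nonempty (puncturedSphere d m ≃ₜ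
      {s : CentredConf n d // ‖s‖ = 1 ∧ ∀ C, s ∉ coincide d C}) := by
  obtain ⟨H, -⟩ : ∃ H : puncturedSphere d m ≃ₜ
      {q : Conf d m | q ∈ (collisionSet d m)ᶜ ∧ ‖centreEquiv hn hm q‖ = 1},
      ∀ s, (H s).1 = (‖centreEquiv hn hm s.1‖)⁻¹ • s.1 := by
    refine exists_radial_homeomorph (ν := fun q => ‖centreEquiv hn hm q‖) continuous_inertia.sqrt
      (continuous_centreEquiv hn hm).norm ?_ ?_ ?_ ?_ ?_ mem_puncturedSphere_iff
      (fun x => Iff.rfl)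
    · intro x hx t ht
      exact smul_mem_compl_collisionSet hx t ht
    · exact fun x hx => sqrt_inertia_pos hn hm hx
    · exact fun x hx => norm_pos_iff.2 ((centreEquiv hn hm).map_ne_zero_iff.2
        (ne_zero_of_notMem_collisionSet hn hx))
    · intro x t ht
      exact sqrt_inertia_smul x t ht
    · intro x t ht
      rw [map_smul, norm_smul, Real.norm_of_nonneg ht.le]
  let T : Conf d m ≃ₜ CentredConf n d :=
    ⟨(centreEquiv hn hm).toEquiv, continuous_centreEquiv hn hm, continuous_centreEquiv_symm hn hm⟩
  refine ⟨H.trans (T.subtype fun q => ?_)⟩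
  refine and_comm.trans (and_congr Iff.rfl ?_)
  exact (forall_centreEquiv_notMem_iff hn hm q).symm

theorem nonempty_homeomorph_blowUpBoundary (hn : 2 ≤ n) (hm : ∀ i, 0 < m i) :
    Nonempty (puncturedSphere d m ≃ₜ blowUpBoundary d hm) := by
  have := nonempty_collisionPartition hn
  obtain ⟨D⟩ := id this
  obtain ⟨H⟩ := (isSphericalBlowUp_graphBlowUp (d := d) hn hm D).nonempty_homeomorph
    isAveragingFamily_coincide
  obtain ⟨H'⟩ := nonempty_homeomorph_puncturedSphere (d := d) hn hm
  have hiff : ∀ b : graphBlowUp d hm,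
      (∃ C, centreEquiv hn hm (basePoint D b.1) ∈ coincide d C) ↔ b.1 ∈ blowUpBoundary d hm := by
    intro b
    rw [mem_blowUpBoundary_iff hm D, and_iff_right b.2, ← not_iff_not,
      ← forall_centreEquiv_notMem_iff hn hm, not_exists]
  let S : {b : graphBlowUp d hm // ∃ C, centreEquiv hn hm (basePoint D b.1) ∈ coincide d C} ≃ₜ
      blowUpBoundary d hm :=
    { toFun := fun b => ⟨b.1.1, (hiff b.1).1 b.2⟩
      invFun := fun b => ⟨⟨b.1, b.2.1⟩, (hiff ⟨b.1, b.2.1⟩).2 b.2⟩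
      left_inv := fun _ => rfl
      right_inv := fun _ => rfl
      continuous_toFun := (continuous_subtype_val.comp continuous_subtype_val).subtype_mk _
      continuous_invFun := (continuous_subtype_val.subtype_mk _).subtype_mk _ }
  exact ⟨(H'.trans H.symm).trans S⟩

end GraphBlowUp

end NBody

theorem theorem5p3 (n d : ℕ) (hn : 2 ≤ n) (hd : 1 ≤ d) (m : Fin n → ℝ) (hm : ∀ i, 0 < m i)
    (δ : ℝ) (hδ : δ ∈ Set.Ioo (0 : ℝ) 1) :
    (∃ H : NBody.puncturedSphere d m ≃ₜ NBody.freeBoundary d hm δ,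
      ∀ s : NBody.puncturedSphere d m,
        {q : NBody.Conf d m | ∃ t : ℝ, 0 < t ∧ q = t • s.1} ∩ NBody.freeBoundary d hm δ
          = {(H s).1}) ∧
    Nonempty (NBody.freeBoundary d hm δ ≃ₜ NBody.blowUpBoundary d hm) := by
  obtain ⟨H, hH⟩ := NBody.exists_homeomorph_freeBoundary (d := d) hn hm hδ
  obtain ⟨S⟩ := NBody.nonempty_homeomorph_blowUpBoundary (d := d) hn hm
  exact ⟨⟨H, hH⟩, ⟨H.symm.trans S⟩⟩
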